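/- **Setting.** In a linear contract setting there are finite sets of actions $\mathcal A$, states $\mathcal Y$ and outcomes, an outcome map $o(a,y)$, outcome values $v(o)\in[0,1]$, pairwise distinct costs $c(a)\in[0,1]$, the policy space $\mathcal P=[0,1]$, and a finite nonempty set $\mathcal P_0\subseteq\mathcal P$ of benchmark policies. The Principal's and Agent's utilities are $V(a,p,y)=(1-p)\,v(o(a,y))$ and $U(a,p,y)=p\,v(o(a,y))-c(a)$. For a prior $\pi$ on $\mathcal Y$, $a^*(p,\pi)$ is an action maximizing the Agent's expected utility $\mathbb E_{y\sim\pi}U(a,p,y)$ and, among the maximizers, maximizing the Principal's expected utility $\mathbb E_{y\sim\pi}V(a,p,y)$ (remaining ties broken arbitrarily). **Interaction.** A mechanism $\sigma$ for horizon $T$ is randomized and nonresponsive: in round $t$, as a function of the past states $y_{1:t-1}$ and its own randomness, it produces a forecast $\pi_t\in\Delta(\mathcal Y)$, a policy $p_t\in\mathcal P$ and a recommendation $r_t\in\mathcal A$. (This includes the mechanisms with $p_t=\psi(\pi_t)$ and $r_t=a^*(p_t,\pi_t)$.) An Agent algorithm $\mathcal L$ for horizon $T$ draws $a_t$ from a distribution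 that is a function of $y_{1:t-1},a_{1:t-1},r_{1:t},p_{1:t}$. For $p_0\in\mathcal P_0$ the constant mechanism always offers $p_0$ and recommends $r^{p_0}_t=a^*(p_0,\pi_t)$, with the same forecasts. For given sequences $y,p,r$, with the actions generated by $\mathcal L$, let $$\mathrm{SwapReg}(y,p,r)=\mathbb E_{a}\Big[\max_{h:\mathcal P\times\mathcal A\times\mathcal A\to\mathcal A}\tfrac1T\sum_{t=1}^T\big(U(h(p_t,r_t,a_t),p_t,y_t)-U(a_t,p_t,y_t)\big)\Big],$$ $$\mathrm{NegReg}(y,p,r)=\tfrac1T\,\mathbb E_{a}\Big[\sum_{t=1}^TU(a_t,p_t,y_t)-\max_{h:\mathcal P\times\mathcal A\to\mathcal A}\sum_{t=1}^TU(h(p_t,r_t),p_t,y_t)\Big].$$ The Principal's policy regret is $$\mathrm{PR}(\sigma,\mathcal L,y)=\mathbb E_\sigma\Big[\max_{p_0\in\mathcal P_0}\mathbb E_{a,a^{p_0}}\,\tfrac1T\sum_{t=1}^T\big(V(a^{p_0}_t,p_0,y_t)-V(a_t,p_t,y_t)\big)\Big],$$ where $a$ and $a^{p_0}$ are the actions that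 $\mathcal L$ generates under $\sigma$ and under the constant mechanism $p_0$. A family $\mathcal L=(\mathcal L^T)_T$ *has vanishing regrets* against a family of mechanisms $\sigma=(\sigma^T)_T$ if there are sequences $\epsilon_{\rm swap}(T)\to0$ and $\epsilon_{\rm neg}(T)\to0$ such that for every $T$, every $y\in\mathcal Y^T$ and almost every realization of $\sigma^T$ one has $\mathrm{SwapReg}\le\epsilon_{\rm swap}(T)$ and $\mathrm{NegReg}\le\epsilon_{\rm neg}(T)$, both for the realized policies and recommendations of $\sigma^T$ and for those of every constant mechanism $p_0\in\mathcal P_0$. **Proposition.** There exist a linear contract setting with two actions, two states and two outcomes, and a constant $c>0$, such that for every choice of the tie-breaking in $a^*$ and every family of Principal mechanisms $\sigma=(\sigma^T)_T$ at least one of the following holds: 1. no family of Agent algorithms has vanishing regrets against $\sigma$; 2. there is a family $\mathcal L^*$ of Agent algorithms that has vanishing regrets against $\sigma$ and such that for all sufficiently large $T$ there is a state sequence $\bar y\in\mathcal Y^T$ with $\mathrm{PR}(\sigma^T,\mathcal L^{*T},\bar y)\ge c$. -/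

import Mathlib

open Filter Topology MeasureTheory

noncomputable section

/-- The space of linear contracts: the fraction of the outcome value paid to the Agent. -/
abbrev Policy : Type := unitInterval

/-- A linear contract setting with actions `A`, states `Y`, outcomes `O` and policy space `[0,1]`. -/
structure LinearContract (A Y O : Type) where
  /-- the outcome produced by an action in a state -/
  outcome : A → Y → O
  /-- the value of an outcome -/
  value : O → ℝ
  value_mem : ∀ o, value o ∈ Set.Icc (0 : ℝ) 1
  /-- the Agent's cost of an action -/
  cost : A → ℝ
  cost_mem : ∀ a, cost a ∈ Set.Icc (0 : ℝ) 1
  cost_injective : Function.Injective cost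
  /-- the finite set of benchmark policies -/
  benchmark : Finset Policy
  benchmark_nonempty : benchmark.Nonempty

/-- A (possibly randomized) nonresponsive Principal mechanism for horizon `T`: in each round,
given the states revealed so far and its own internal randomness `ω ∼ law`, it issues a forecast
of the state, a policy and a recommended action. It never sees the Agent's actions. Its own past
forecasts, policies and recommendations are functions of `ω` and of the state history, so
dependence on them is included. No relation between the three outputs is imposed; mechanisms of
the form `p_t = ψ(π_t)`, `r_t = a^*(p_t, π_t)` are a special case. -/
structure Mechanism (A Y : Type) [Fintype Y] (T : ℕ) where
  Ω : Type
  [measurableSpace : MeasurableSpace Ω]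
  law : Measure Ω
  [isProb : IsProbabilityMeasure law]
  forecast : (t : Fin T) → (Fin t → Y) → Ω → stdSimplex ℝ Y
  policy : (t : Fin T) → (Fin t → Y) → Ω → Policy
  recommend : (t : Fin T) → (Fin t → Y) → Ω → A
  measurable_forecast : ∀ t h, Measurable (forecast t h)
  measurable_policy : ∀ t h, Measurable (policy t h)
  measurableSet_recommend : ∀ t h a, MeasurableSet {ω | recommend t h ω = a}

attribute [instance] Mechanism.measurableSpace Mechanism.isProb

namespace Mechanism

variable {A Y : Type} [Fintype Y] {T : ℕ}

/-- The forecasts `π_{1:T}` realized on the state sequence `y`. -/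
def forecasts (σ : Mechanism A Y T) (y : Fin T → Y) (ω : σ.Ω) (t : Fin T) : stdSimplex ℝ Y :=
  σ.forecast t (Fin.take t t.isLt.le y) ω

/-- The policies `p_{1:T}` realized on the state sequence `y`. -/
def policies (σ : Mechanism A Y T) (y : Fin T → Y) (ω : σ.Ω) (t : Fin T) : Policy :=
  σ.policy t (Fin.take t t.isLt.le y) ω

/-- The recommendations `r_{1:T}` realized on the state sequence `y`. -/
def recommendations (σ : Mechanism A Y T) (y : Fin T → Y) (ω : σ.Ω) (t : Fin T) : A :=
  σ.recommend t (Fin.take t t.isLt.le y) ω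

end Mechanism

/-- An Agent learning algorithm for horizon `T`: the distribution of the action in round `t` is a
function of the past states, the past actions, and the past and current recommendations and
policies. -/
structure AgentAlg (A Y : Type) [Fintype A] (T : ℕ) where
  act : (t : Fin T) → (Fin t → Y) → (Fin t → A) → (Fin (t + 1) → A) → (Fin (t + 1) → Policy) →
    stdSimplex ℝ A
  measurable_act : ∀ t y a r, Measurable (act t y a r)

namespace AgentAlg

variable {A Y : Type} [Fintype A] {T : ℕ}

/-- The probability that the algorithm generates the actions `a`, when the states, policies and
recommendations are `y`, `p`, `r`. -/
def prob (L : AgentAlg A Y T) (y : Fin T → Y) (p : Fin T → Policy) (r a : Fin T → A) : ℝ :=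
  ∏ t : Fin T, (L.act t (Fin.take t t.isLt.le y) (Fin.take t t.isLt.le a)
    (Fin.take (t + 1) t.isLt r) (Fin.take (t + 1) t.isLt p) : A → ℝ) (a t)

/-- The expectation of `f a` over the generated action sequence `a`. -/
def expect (L : AgentAlg A Y T) (y : Fin T → Y) (p : Fin T → Policy) (r : Fin T → A)
    (f : (Fin T → A) → ℝ) : ℝ :=
  ∑ a : Fin T → A, L.prob y p r a * f a

end AgentAlg

namespace LinearContract

variable {A Y O : Type}

/-- The Principal's utility `V(a,p,y)`. -/
def V (S : LinearContract A Y O) (a : A) (p : Policy) (y : Y) : ℝ :=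
  (1 - (p : ℝ)) * S.value (S.outcome a y)

/-- The Agent's utility `U(a,p,y)`. -/
def U (S : LinearContract A Y O) (a : A) (p : Policy) (y : Y) : ℝ :=
  (p : ℝ) * S.value (S.outcome a y) - S.cost a

/-- The Principal's expected utility under the prior `π`. -/
def expV [Fintype Y] (S : LinearContract A Y O) (a : A) (p : Policy) (π : stdSimplex ℝ Y) : ℝ :=
  ∑ y, (π : Y → ℝ) y * S.V a p y

/-- The Agent's expected utility under the prior `π`. -/
def expU [Fintype Y] (S : LinearContract A Y O) (a : A) (p : Policy) (π : stdSimplex ℝ Y) : ℝ :=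
  ∑ y, (π : Y → ℝ) y * S.U a p y

/-- `a` is a best response of the Agent to `(p, π)`. -/
def IsBestResponse [Fintype Y] (S : LinearContract A Y O) (p : Policy) (π : stdSimplex ℝ Y)
    (a : A) : Prop :=
  ∀ b, S.expU b p π ≤ S.expU a p π

/-- A choice `a^*(p, π)` of a best response that is optimal for the Principal among all best
responses; remaining ties are broken arbitrarily (but measurably). -/
structure OptimisticResponse [Fintype Y] (S : LinearContract A Y O) where
  toFun : Policy → stdSimplex ℝ Y → A
  isBestResponse : ∀ p π, S.IsBestResponse p π (toFun p π)
  optimistic : ∀ p π b, S.IsBestResponse p π b → S.expV b p π ≤ S.expV (toFun p π) p π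
  measurableSet_eq : ∀ p a, MeasurableSet {π | toFun p π = a}

/-- The recommendations `r_t^{p₀} = a^*(p₀, π_t)` of the constant mechanism that always offers
`p₀`, under the forecasts realized by `σ`. -/
def constRecommendations [Fintype Y] {S : LinearContract A Y O} {T : ℕ}
    (astar : S.OptimisticResponse) (σ : Mechanism A Y T) (p₀ : Policy) (y : Fin T → Y) (ω : σ.Ω)
    (t : Fin T) : A :=
  astar.toFun p₀ (σ.forecasts y ω t)

section Regret

variable [Fintype A] {T : ℕ}

/-- The Agent's contextual swap regret on states `y`, policies `p` and recommendations `r`. -/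
def swapRegret (S : LinearContract A Y O) (L : AgentAlg A Y T) (y : Fin T → Y)
    (p : Fin T → Policy) (r : Fin T → A) : ℝ :=
  L.expect y p r fun a => ⨆ h : Policy → A → A → A,
    (1 / (T : ℝ)) * ∑ t, (S.U (h (p t) (r t) (a t)) (p t) (y t) - S.U (a t) (p t) (y t))

/-- The Agent's negative cross-swap-regret on states `y`, policies `p` and recommendations `r`. -/
def negRegret (S : LinearContract A Y O) (L : AgentAlg A Y T) (y : Fin T → Y)
    (p : Fin T → Policy) (r : Fin T → A) : ℝ :=
  (1 / (T : ℝ)) * L.expect y p r fun a => (∑ t, S.U (a t) (p t) (y t)) -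
    ⨆ h : Policy → A → A, ∑ t, S.U (h (p t) (r t)) (p t) (y t)

/-- The Principal's expected average utility on states `y`, when the policies and recommendations
are `p` and `r` and the Agent runs `L`. -/
def principalValue (S : LinearContract A Y O) (L : AgentAlg A Y T) (y : Fin T → Y)
    (p : Fin T → Policy) (r : Fin T → A) : ℝ :=
  L.expect y p r fun a => (1 / (T : ℝ)) * ∑ t, S.V (a t) (p t) (y t)

variable [Fintype Y]

/-- No contextual swap regret on the state sequence `y`, for almost every realization of `σ`:
both along the realized play and under every constant benchmark mechanism. -/
def NoContextualSwapRegret (S : LinearContract A Y O) (astar : S.OptimisticResponse)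
    (σ : Mechanism A Y T) (L : AgentAlg A Y T) (y : Fin T → Y) (ε : ℝ) : Prop :=
  ∀ᵐ ω ∂σ.law,
    S.swapRegret L y (σ.policies y ω) (σ.recommendations y ω) ≤ ε ∧
    ∀ p₀ ∈ S.benchmark,
      S.swapRegret L y (fun _ => p₀) (constRecommendations astar σ p₀ y ω) ≤ ε

/-- No negative cross-swap-regret on the state sequence `y`, for almost every realization of `σ`:
both along the realized play and under every constant benchmark mechanism. -/
def NoNegativeCrossSwapRegret (S : LinearContract A Y O) (astar : S.OptimisticResponse)
    (σ : Mechanism A Y T) (L : AgentAlg A Y T) (y : Fin T → Y) (ε : ℝ) : Prop :=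
  ∀ᵐ ω ∂σ.law,
    S.negRegret L y (σ.policies y ω) (σ.recommendations y ω) ≤ ε ∧
    ∀ p₀ ∈ S.benchmark,
      S.negRegret L y (fun _ => p₀) (constRecommendations astar σ p₀ y ω) ≤ ε

/-- The Principal's policy regret: the expectation over the mechanism's randomness of the largest
difference, over benchmark policies `p₀`, between the Principal's expected average utility under
the constant mechanism `p₀` and under the realized play. In each of the two scenarios the Agent's
actions are generated by `L` from the policies and recommendations of that scenario. -/
def policyRegret (S : LinearContract A Y O) (astar : S.OptimisticResponse)
    (σ : Mechanism A Y T) (L : AgentAlg A Y T) (y : Fin T → Y) : ℝ :=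
  ∫ ω, S.benchmark.sup' S.benchmark_nonempty (fun p₀ =>
    S.principalValue L y (fun _ => p₀) (constRecommendations astar σ p₀ y ω) -
      S.principalValue L y (σ.policies y ω) (σ.recommendations y ω)) ∂σ.law

/-- A family of Agent algorithms, one for each horizon, that has vanishing contextual swap regret
and vanishing negative cross-swap-regret against the family `σ`, uniformly over all state
sequences. -/
def VanishingRegrets (S : LinearContract A Y O) (astar : S.OptimisticResponse)
    (σ : ∀ T, Mechanism A Y T) (L : ∀ T, AgentAlg A Y T) : Prop :=
  ∃ εswap εneg : ℕ → ℝ, Tendsto εswap atTop (𝓝 0) ∧ Tendsto εneg atTop (𝓝 0) ∧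
    ∀ (T : ℕ) (y : Fin T → Y),
      S.NoContextualSwapRegret astar (σ T) (L T) y (εswap T) ∧
      S.NoNegativeCrossSwapRegret astar (σ T) (L T) y (εneg T)

end Regret

end LinearContract

end

/-! In `workContract` working costs 1/2 and succeeds only in the good state; the two benchmark
policies lie slightly above 1/2. Start from any Agent `L` with vanishing regrets, fix a benchmark
`q` and a guess `z` of the state sequence, and let the Agent turn some shirking into work in rounds
with policy `q`, as long as the states have followed `z`. For each recommendation a ledger records
the gains from these switches: at a nonpositive balance the Agent switches in the good state, at a
positive one in the bad state, so the balance stays bounded. Swap functions see only policy,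
recommendation and action, so the switches affect the regrets only through the ledger, and both
regrets grow by at most 4/T on every state sequence (`swapRegret_relabel_le`,
`negRegret_relabel_le`).

Now let the states `y` be uniformly random and take `z = y`. The algorithm `L` itself cannot predict
them (`AgentAlg.sum_expect_mul_eq_zero`). Under the constant policy `q`, work gains q - 1/2 in a
good state and loses 1/2 in a bad one, so a balanced ledger forces work in a fraction of about
1/(2q) of the good states, and the Principal earns on average at least about (1-q)/(4q) per round
(`le_sum_principalValue_const`). Under the mechanism, the two utilities add up to 1/2 or -1/2 for
work and to 0 for shirking. This welfare averages to 0 over uninformed rounds and to at most 1/4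
over rounds with policy `q`, while low swap regret keeps the Agent's total utility from being very
negative. So the Principal earns at most about 1/4 of the share of rounds with policy `q`
(`sum_principalValue_le`).

A nonresponsive mechanism plays the same policies whichever `q` the Agent is informed on. The shares
of the two benchmarks add up to at most 1, whereas their values (1-q)/(4q) add up to 31/90 > 1/4.
Hence some `q` and `y` leave regret bounded away from 0 (`exists_le_policyRegret`).

The switching Agent has to be an algorithm that recalls only the actions it actually played.
`AgentAlg.relabel` achieves this by playing the conditional law of the relabelled action given the
relabelled past. -/

noncomputable section

/-! ### Prefixes of finite sequences -/

/-- Two sequences agree at all indices below `n`. -/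
def AgreeBelow {α : Type} {T : ℕ} (n : ℕ) (a b : Fin T → α) : Prop :=
  ∀ s : Fin T, (s : ℕ) < n → a s = b s

namespace AgreeBelow

variable {α : Type} {T n m : ℕ} {a b : Fin T → α}

theorem refl (n : ℕ) (a : Fin T → α) : AgreeBelow n a a := fun _ _ => rfl

theorem mono (h : AgreeBelow n a b) (hm : m ≤ n) : AgreeBelow m a b :=
  fun s hs => h s (hs.trans_le hm)

theorem update (a : Fin T → α) (t : Fin T) (x : α) :
    AgreeBelow (t : ℕ) (Function.update a t x) a := fun s hs =>
  Function.update_of_ne (fun h => by simp [h] at hs) _ _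

theorem take (h : AgreeBelow n a b) (hn : n ≤ T) : Fin.take n hn a = Fin.take n hn b := by
  funext i
  exact h _ i.isLt

end AgreeBelow

/-- A finite sequence extended to length `T` by an arbitrary value. -/
def extendSeq {α : Type} [Nonempty α] (T : ℕ) {n : ℕ} (v : Fin n → α) : Fin T → α :=
  fun s => if h : (s : ℕ) < n then v ⟨s, h⟩ else Classical.arbitrary α

theorem agreeBelow_extendSeq_take {α : Type} [Nonempty α] {T n : ℕ} (hn : n ≤ T)
    (a : Fin T → α) : AgreeBelow n (extendSeq T (Fin.take n hn a)) a := by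
  intro s hs
  simp only [extendSeq, hs, dite_true]
  rfl

theorem measurable_extendSeq {α : Type} [Nonempty α] [MeasurableSpace α] (T : ℕ) {n : ℕ} :
    Measurable (extendSeq T : (Fin n → α) → Fin T → α) := by
  refine measurable_pi_iff.2 fun s => ?_
  unfold extendSeq
  by_cases h : (s : ℕ) < n
  · simpa [h] using measurable_pi_apply _
  · simp [h]

/-- Summing over all sequences is averaging over the redrawing of one coordinate. -/
theorem card_mul_sum_eq_sum_update {A : Type} [Fintype A] {T : ℕ} (t : Fin T)
    (F : (Fin T → A) → ℝ) :
    (Fintype.card A : ℝ) * ∑ a, F a = ∑ a, ∑ b, F (Function.update a t b) := by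
  classical
  rw [← Equiv.sum_comp (Equiv.funSplitAt t A).symm, Fintype.sum_prod_type]
  rw [← Equiv.sum_comp (Equiv.funSplitAt t A).symm, Fintype.sum_prod_type]
  have key : ∀ (x : A) (g : {j // j ≠ t} → A) (b : A),
      Function.update ((Equiv.funSplitAt t A).symm (x, g)) t b =
        (Equiv.funSplitAt t A).symm (b, g) := by
    intro x g b
    funext s
    by_cases hs : s = t
    · subst hs; simp [Equiv.funSplitAt, Equiv.piSplitAt]
    · simp [Equiv.funSplitAt, Equiv.piSplitAt, hs]
  simp only [key, Finset.sum_const, Finset.card_univ, nsmul_eq_mul]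
  rw [Finset.sum_comm]

/-! ### Prefix probabilities and expectations of an Agent algorithm -/

namespace AgentAlg

variable {A Y : Type} [Fintype A] {T : ℕ}

/-- The probability of the action `a t`, given the history up to round `t`. -/
def stepProb (L : AgentAlg A Y T) (y : Fin T → Y) (p : Fin T → Policy) (r a : Fin T → A)
    (t : Fin T) : ℝ :=
  (L.act t (Fin.take t t.isLt.le y) (Fin.take t t.isLt.le a)
    (Fin.take (t + 1) t.isLt r) (Fin.take (t + 1) t.isLt p) : A → ℝ) (a t)

theorem stepProb_congr (L : AgentAlg A Y T) {y y' : Fin T → Y} {p p' : Fin T → Policy}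
    {r r' a a' : Fin T → A} {t : Fin T} (hy : AgreeBelow t y y') (hp : AgreeBelow (t + 1) p p')
    (hr : AgreeBelow (t + 1) r r') (ha : AgreeBelow (t + 1) a a') :
    L.stepProb y p r a t = L.stepProb y' p' r' a' t := by
  simp only [stepProb, hy.take, hp.take, hr.take, (ha.mono (Nat.le_succ _)).take,
    ha t (Nat.lt_succ_self _)]

theorem stepProb_nonneg (L : AgentAlg A Y T) (y : Fin T → Y) (p : Fin T → Policy)
    (r a : Fin T → A) (t : Fin T) : 0 ≤ L.stepProb y p r a t :=
  (L.act t _ _ _ _).2.1 _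

theorem sum_stepProb_update (L : AgentAlg A Y T) (y : Fin T → Y) (p : Fin T → Policy)
    (r a : Fin T → A) (t : Fin T) :
    ∑ b, L.stepProb y p r (Function.update a t b) t = 1 := by
  have h : ∀ b, L.stepProb y p r (Function.update a t b) t =
      (L.act t (Fin.take t t.isLt.le y) (Fin.take t t.isLt.le a)
        (Fin.take (t + 1) t.isLt r) (Fin.take (t + 1) t.isLt p) : A → ℝ) b := by
    intro b
    simp only [stepProb, (AgreeBelow.update a t b).take, Function.update_self]
  simp only [h]
  exact (L.act t _ _ _ _).2.2

theorem measurable_stepProb (L : AgentAlg A Y T) (y : Fin T → Y) (r a : Fin T → A) (t : Fin T) :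
    Measurable fun p => L.stepProb y p r a t := by
  unfold stepProb
  have h1 : Measurable fun p : Fin T → Policy => Fin.take (t + 1) t.isLt p :=
    measurable_pi_iff.2 fun i => measurable_pi_apply _
  exact (measurable_pi_apply (a t)).comp
    (measurable_subtype_coe.comp ((L.measurable_act t _ _ _).comp h1))

/-- The probability of the first `n` actions of `a`. -/
def prefixProb (L : AgentAlg A Y T) (n : ℕ) (y : Fin T → Y) (p : Fin T → Policy)
    (r a : Fin T → A) : ℝ :=
  ∏ t ∈ Finset.univ.filter fun t : Fin T => (t : ℕ) < n, L.stepProb y p r a t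

theorem prefixProb_self (L : AgentAlg A Y T) : L.prefixProb T = L.prob := by
  funext y p r a
  simp [prefixProb, prob, stepProb]

theorem prefixProb_succ (L : AgentAlg A Y T) (t : Fin T) (y : Fin T → Y) (p : Fin T → Policy)
    (r a : Fin T → A) :
    L.prefixProb (t + 1) y p r a = L.prefixProb t y p r a * L.stepProb y p r a t := by
  have h : (Finset.univ.filter fun s : Fin T => (s : ℕ) < t + 1) =
      insert t (Finset.univ.filter fun s : Fin T => (s : ℕ) < t) := by
    ext s
    simp only [Finset.mem_filter, Finset.mem_univ, true_and, Finset.mem_insert, Fin.ext_iff]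
    omega
  rw [prefixProb, h, Finset.prod_insert (by simp), mul_comm]
  rfl

theorem prefixProb_nonneg (L : AgentAlg A Y T) (n : ℕ) (y : Fin T → Y) (p : Fin T → Policy)
    (r a : Fin T → A) : 0 ≤ L.prefixProb n y p r a :=
  Finset.prod_nonneg fun t _ => L.stepProb_nonneg y p r a t

theorem prefixProb_congr (L : AgentAlg A Y T) {n : ℕ} {y y' : Fin T → Y}
    {p p' : Fin T → Policy} {r r' a a' : Fin T → A} (hy : AgreeBelow (n - 1) y y')
    (hp : AgreeBelow n p p') (hr : AgreeBelow n r r') (ha : AgreeBelow n a a') :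
    L.prefixProb n y p r a = L.prefixProb n y' p' r' a' := by
  refine Finset.prod_congr rfl fun t ht => ?_
  have ht : (t : ℕ) < n := by simpa using ht
  exact L.stepProb_congr (hy.mono (by omega)) (hp.mono ht) (hr.mono ht) (ha.mono ht)

theorem measurable_prefixProb (L : AgentAlg A Y T) (n : ℕ) (y : Fin T → Y) (r a : Fin T → A) :
    Measurable fun p => L.prefixProb n y p r a :=
  Finset.measurable_fun_prod _ fun t _ => L.measurable_stepProb y r a t

theorem prob_nonneg (L : AgentAlg A Y T) (y : Fin T → Y) (p : Fin T → Policy)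
    (r a : Fin T → A) : 0 ≤ L.prob y p r a :=
  L.prefixProb_self ▸ L.prefixProb_nonneg T y p r a

/-- The last action of a prefix sums out. -/
theorem card_mul_sum_prefixProb_succ (L : AgentAlg A Y T) (t : Fin T) (y : Fin T → Y)
    (p : Fin T → Policy) (r : Fin T → A) (f : (Fin T → A) → ℝ)
    (hf : ∀ a a', AgreeBelow t a a' → f a = f a') :
    (Fintype.card A : ℝ) * ∑ a, L.prefixProb (t + 1) y p r a * f a =
      ∑ a, L.prefixProb t y p r a * f a := by
  rw [card_mul_sum_eq_sum_update t]
  refine Finset.sum_congr rfl fun a _ => ?_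
  have h : ∀ b, L.prefixProb (t + 1) y p r (Function.update a t b) * f (Function.update a t b) =
      L.prefixProb t y p r a * f a * L.stepProb y p r (Function.update a t b) t := by
    intro b
    rw [prefixProb_succ, hf _ _ (AgreeBelow.update a t b),
      L.prefixProb_congr (AgreeBelow.refl _ y) (AgreeBelow.refl _ p) (AgreeBelow.refl _ r)
        (AgreeBelow.update a t b)]
    ring
  simp only [h, ← Finset.mul_sum, sum_stepProb_update, mul_one]

/-- The right side still sums over full sequences, so each of the `k` rounds beyond the prefix is
counted `card A` times. This normalization avoids a separate type for each prefix length. -/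
theorem card_pow_mul_expect (L : AgentAlg A Y T) (y : Fin T → Y) (p : Fin T → Policy)
    (r : Fin T → A) (f : (Fin T → A) → ℝ) (k n : ℕ) (hk : n + k = T)
    (hf : ∀ a a', AgreeBelow n a a' → f a = f a') :
    (Fintype.card A : ℝ) ^ k * L.expect y p r f = ∑ a, L.prefixProb n y p r a * f a := by
  induction k generalizing n with
  | zero =>
    obtain rfl : n = T := by omega
    simp [expect, prefixProb_self]
  | succ k ih =>
    have h := L.card_mul_sum_prefixProb_succ ⟨n, by omega⟩ y p r f hf
    rw [← h, ← ih (n + 1) (by omega) fun a a' ha => hf a a' (ha.mono (Nat.le_succ _))]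
    ring

/-- The expectation of a function of the first `t + 1` actions depends only on the data of the
first `t + 1` rounds, without the state of the last of them. -/
theorem expect_congr [Nonempty A] (L : AgentAlg A Y T) {y y' : Fin T → Y}
    {p p' : Fin T → Policy} {r r' : Fin T → A} {f f' : (Fin T → A) → ℝ} (t : Fin T)
    (hy : AgreeBelow t y y') (hp : AgreeBelow (t + 1) p p') (hr : AgreeBelow (t + 1) r r')
    (hf : ∀ a a', AgreeBelow (t + 1) a a' → f a = f' a') :
    L.expect y p r f = L.expect y' p' r' f' := by
  have hff : ∀ a, f a = f' a := fun a => hf a a (AgreeBelow.refl _ a)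
  obtain rfl : f = f' := funext hff
  have hc : (Fintype.card A : ℝ) ^ (T - (t + 1)) ≠ 0 := by positivity
  refine mul_left_cancel₀ hc ?_
  have ht := t.isLt
  rw [L.card_pow_mul_expect y p r f _ (t + 1) (by omega) hf,
    L.card_pow_mul_expect y' p' r' f _ (t + 1) (by omega) hf]
  refine Finset.sum_congr rfl fun a _ => ?_
  rw [L.prefixProb_congr (n := t + 1) (by simpa using hy) hp hr (AgreeBelow.refl _ a)]

theorem sum_prob [Nonempty A] (L : AgentAlg A Y T) (y : Fin T → Y) (p : Fin T → Policy)
    (r : Fin T → A) : ∑ a, L.prob y p r a = 1 := by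
  have h := L.card_pow_mul_expect y p r (fun _ => 1) T 0 (by omega) fun _ _ _ => rfl
  simp only [expect, mul_one, prefixProb, Nat.not_lt_zero, Finset.filter_false,
    Finset.prod_empty, Finset.sum_const, Finset.card_univ, Fintype.card_pi, Fintype.card_fin,
    Finset.prod_const, nsmul_eq_mul, Nat.cast_pow] at h
  have hc : (Fintype.card A : ℝ) ^ T ≠ 0 := by positivity
  exact mul_left_cancel₀ hc (by rw [h, mul_one])

theorem expect_mono (L : AgentAlg A Y T) {y : Fin T → Y} {p : Fin T → Policy}
    {r : Fin T → A} {f g : (Fin T → A) → ℝ} (h : ∀ a, f a ≤ g a) :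
    L.expect y p r f ≤ L.expect y p r g :=
  Finset.sum_le_sum fun a _ => mul_le_mul_of_nonneg_left (h a) (L.prob_nonneg y p r a)

theorem expect_add (L : AgentAlg A Y T) (y : Fin T → Y) (p : Fin T → Policy)
    (r : Fin T → A) (f g : (Fin T → A) → ℝ) :
    L.expect y p r (fun a => f a + g a) = L.expect y p r f + L.expect y p r g := by
  simp [expect, mul_add, Finset.sum_add_distrib]

theorem expect_const_mul (L : AgentAlg A Y T) (y : Fin T → Y) (p : Fin T → Policy)
    (r : Fin T → A) (c : ℝ) (f : (Fin T → A) → ℝ) :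
    L.expect y p r (fun a => c * f a) = c * L.expect y p r f := by
  simp only [expect, Finset.mul_sum]
  exact Finset.sum_congr rfl fun _ _ => by ring

theorem expect_sum {ι : Type} (L : AgentAlg A Y T) (y : Fin T → Y) (p : Fin T → Policy)
    (r : Fin T → A) (s : Finset ι) (f : ι → (Fin T → A) → ℝ) :
    L.expect y p r (fun a => ∑ i ∈ s, f i a) = ∑ i ∈ s, L.expect y p r (f i) := by
  simp only [expect, Finset.mul_sum]
  exact Finset.sum_comm

theorem expect_const [Nonempty A] (L : AgentAlg A Y T) (y : Fin T → Y) (p : Fin T → Policy)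
    (r : Fin T → A) (c : ℝ) : L.expect y p r (fun _ => c) = c := by
  simp [expect, ← Finset.sum_mul, sum_prob]

end AgentAlg

/-! ### Simulating an algorithm with relabelled actions -/

/-- A rule that replaces each action of a sequence, given the data available to an Agent
algorithm and the actions replaced so far. -/
structure CausalRelabeling (A Y : Type) (T : ℕ) where
  toFun : (Fin T → Y) → (Fin T → Policy) → (Fin T → A) → (Fin T → A) → Fin T → A
  causal : ∀ (t : Fin T) {y y' : Fin T → Y} {p p' : Fin T → Policy} {r r' a a' : Fin T → A},
    AgreeBelow t y y' → AgreeBelow (t + 1) p p' → AgreeBelow (t + 1) r r' →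
    AgreeBelow (t + 1) a a' → toFun y p r a t = toFun y' p' r' a' t
  measurableSet_eq : ∀ y r a t b, MeasurableSet {p | toFun y p r a t = b}

theorem agreeBelow_congr {α : Type} {T n : ℕ} {u u' v v' : Fin T → α} (hu : AgreeBelow n u u')
    (hv : AgreeBelow n v v') : AgreeBelow n u v ↔ AgreeBelow n u' v' := by
  constructor <;> intro h s hs
  · rw [← hu s hs, h s hs, hv s hs]
  · rw [hu s hs, h s hs, hv s hs]

theorem agreeBelow_relabel {A Y : Type} {T : ℕ} (Φ : CausalRelabeling A Y T) {n : ℕ}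
    {y y' : Fin T → Y}
    {p p' : Fin T → Policy} {r r' a a' : Fin T → A}
    (hy : AgreeBelow (n - 1) y y') (hp : AgreeBelow n p p') (hr : AgreeBelow n r r')
    (ha : AgreeBelow n a a') : AgreeBelow n (Φ.toFun y p r a) (Φ.toFun y' p' r' a') :=
  fun s hs => Φ.causal s (hy.mono (by omega)) (hp.mono hs) (hr.mono hs) (ha.mono hs)

namespace AgentAlg

variable {A Y : Type} [Fintype A] {T : ℕ}

open Classical in
/-- The unnormalized probability that the relabelled actions start with the first `n` entries
of `b`. -/
def relabelMass (L : AgentAlg A Y T) (Φ : CausalRelabeling A Y T) (n : ℕ) (y : Fin T → Y)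
    (p : Fin T → Policy) (r b : Fin T → A) : ℝ :=
  ∑ a, L.prefixProb n y p r a * if AgreeBelow n (Φ.toFun y p r a) b then 1 else 0

theorem relabelMass_nonneg (L : AgentAlg A Y T) (Φ : CausalRelabeling A Y T) (n : ℕ)
    (y : Fin T → Y) (p : Fin T → Policy) (r b : Fin T → A) : 0 ≤ L.relabelMass Φ n y p r b :=
  Finset.sum_nonneg fun a _ => mul_nonneg (L.prefixProb_nonneg n y p r a) (by split_ifs <;> simp)

theorem relabelMass_congr (L : AgentAlg A Y T) (Φ : CausalRelabeling A Y T) {n : ℕ}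
    {y y' : Fin T → Y} {p p' : Fin T → Policy} {r r' b b' : Fin T → A}
    (hy : AgreeBelow (n - 1) y y') (hp : AgreeBelow n p p') (hr : AgreeBelow n r r')
    (hb : AgreeBelow n b b') : L.relabelMass Φ n y p r b = L.relabelMass Φ n y' p' r' b' := by
  classical
  refine Finset.sum_congr rfl fun a _ => ?_
  rw [L.prefixProb_congr hy hp hr (AgreeBelow.refl _ a)]
  congr 1
  exact if_congr (agreeBelow_congr (agreeBelow_relabel Φ hy hp hr (AgreeBelow.refl n a)) hb)
    rfl rfl

/-- The relabelled entry of round `t` equals exactly one `x`, so the sum over `x` removes the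
constraint on that round. By causality the remaining constraint does not involve the original action
of round `t`, which then sums out. -/
theorem card_mul_sum_relabelMass_succ (L : AgentAlg A Y T) (Φ : CausalRelabeling A Y T)
    (t : Fin T) (y : Fin T → Y) (p : Fin T → Policy) (r b : Fin T → A) :
    (Fintype.card A : ℝ) * ∑ x, L.relabelMass Φ (t + 1) y p r (Function.update b t x) =
      L.relabelMass Φ t y p r b := by
  classical
  unfold relabelMass
  rw [Finset.sum_comm]
  have h : ∀ a : Fin T → A, ∑ x, L.prefixProb (t + 1) y p r a *
      (if AgreeBelow (t + 1) (Φ.toFun y p r a) (Function.update b t x) then (1 : ℝ) else 0) =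
      L.prefixProb (t + 1) y p r a * if AgreeBelow t (Φ.toFun y p r a) b then (1 : ℝ) else 0 := by
    intro a
    rw [← Finset.mul_sum]
    congr 1
    have h2 : ∀ x, AgreeBelow (t + 1) (Φ.toFun y p r a) (Function.update b t x) ↔
        Φ.toFun y p r a t = x ∧ AgreeBelow t (Φ.toFun y p r a) b := by
      intro x
      constructor
      · intro h
        refine ⟨by simpa using h t (Nat.lt_succ_self _), fun s hs => ?_⟩
        rw [h s (hs.trans (Nat.lt_succ_self _)), AgreeBelow.update b t x s hs]
      · rintro ⟨h1, h2⟩ s hs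
        by_cases hst : s = t
        · subst hst; simpa using h1
        · have : (s : ℕ) < t := by
            have : (s : ℕ) ≠ t := fun h => hst (Fin.ext h)
            omega
          rw [h2 s this, AgreeBelow.update b t x s this]
    simp only [h2]
    by_cases h3 : AgreeBelow t (Φ.toFun y p r a) b <;> simp [h3]
  rw [Finset.sum_congr rfl fun a _ => h a]
  convert L.card_mul_sum_prefixProb_succ t y p r
    (fun a => if AgreeBelow t (Φ.toFun y p r a) b then (1 : ℝ) else 0) ?_ using 2
  intro a a' ha
  simp only [agreeBelow_congr (agreeBelow_relabel Φ (AgreeBelow.refl _ y) (AgreeBelow.refl _ p)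
    (AgreeBelow.refl _ r) ha) (AgreeBelow.refl _ b)]

theorem measurable_relabelMass (L : AgentAlg A Y T) (Φ : CausalRelabeling A Y T) (n : ℕ)
    (y : Fin T → Y) (r b : Fin T → A) : Measurable fun p => L.relabelMass Φ n y p r b := by
  classical
  refine Finset.measurable_fun_sum _ fun a _ => (L.measurable_prefixProb n y r a).mul ?_
  refine Measurable.ite ?_ measurable_const measurable_const
  have : {p | AgreeBelow n (Φ.toFun y p r a) b} =
      ⋂ s : Fin T, ⋂ _ : (s : ℕ) < n, {p | Φ.toFun y p r a s = b s} := by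
    ext p; simp [AgreeBelow]
  rw [this]
  exact MeasurableSet.iInter fun s => MeasurableSet.iInter fun _ => Φ.measurableSet_eq y r a s _

/-- The conditional distribution of the relabelled action in round `t`. -/
def relabelAct [Nonempty A] (L : AgentAlg A Y T) (Φ : CausalRelabeling A Y T) (t : Fin T)
    (y : Fin T → Y) (b r : Fin T → A) (p : Fin T → Policy) : A → ℝ :=
  if L.relabelMass Φ t y p r b = 0 then fun _ => (Fintype.card A : ℝ)⁻¹
  else fun x => Fintype.card A * L.relabelMass Φ (t + 1) y p r (Function.update b t x) /
    L.relabelMass Φ t y p r b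

theorem relabelAct_mem [Nonempty A] (L : AgentAlg A Y T) (Φ : CausalRelabeling A Y T)
    (t : Fin T) (y : Fin T → Y) (b r : Fin T → A) (p : Fin T → Policy) :
    L.relabelAct Φ t y b r p ∈ stdSimplex ℝ A := by
  unfold relabelAct
  split_ifs with h
  · refine ⟨fun _ => by positivity, ?_⟩
    simp
  · refine ⟨fun x => ?_, ?_⟩
    · have h1 := L.relabelMass_nonneg Φ (t + 1) y p r (Function.update b t x)
      have h2 := L.relabelMass_nonneg Φ t y p r b
      positivity
    · rw [← Finset.sum_div, ← Finset.mul_sum, card_mul_sum_relabelMass_succ, div_self h]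

theorem relabelAct_congr [Nonempty A] (L : AgentAlg A Y T) (Φ : CausalRelabeling A Y T)
    {t : Fin T} {y y' : Fin T → Y} {p p' : Fin T → Policy} {r r' b b' : Fin T → A}
    (hy : AgreeBelow t y y') (hb : AgreeBelow t b b') (hr : AgreeBelow (t + 1) r r')
    (hp : AgreeBelow (t + 1) p p') :
    L.relabelAct Φ t y b r p = L.relabelAct Φ t y' b' r' p' := by
  have h1 : L.relabelMass Φ t y p r b = L.relabelMass Φ t y' p' r' b' :=
    L.relabelMass_congr Φ (hy.mono (by omega)) (hp.mono (by omega)) (hr.mono (by omega)) hb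
  have h2 : ∀ x, L.relabelMass Φ (t + 1) y p r (Function.update b t x) =
      L.relabelMass Φ (t + 1) y' p' r' (Function.update b' t x) := by
    intro x
    refine L.relabelMass_congr Φ (by simpa using hy) hp hr fun s hs => ?_
    by_cases hst : s = t
    · subst hst; simp
    · rw [Function.update_of_ne hst, Function.update_of_ne hst]
      refine hb s ?_
      have : (s : ℕ) ≠ t := fun h => hst (Fin.ext h)
      omega
  simp only [relabelAct, h1, h2]

/-- The Agent algorithm that plays the relabelled actions of a simulated algorithm. -/
def relabel [Nonempty A] [Nonempty Y] (L : AgentAlg A Y T) (Φ : CausalRelabeling A Y T) :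
    AgentAlg A Y T where
  act t y b r p := ⟨L.relabelAct Φ t (extendSeq T y) (extendSeq T b) (extendSeq T r)
    (extendSeq T p), L.relabelAct_mem Φ _ _ _ _ _⟩
  measurable_act t y b r := by
    refine Measurable.subtype_mk (measurable_pi_iff.2 fun x => ?_)
    have h : Measurable fun p => L.relabelAct Φ t (extendSeq T y) (extendSeq T b)
        (extendSeq T r) p x := by
      have h2 : ∀ p, L.relabelAct Φ t (extendSeq T y) (extendSeq T b) (extendSeq T r) p x =
          if L.relabelMass Φ t (extendSeq T y) p (extendSeq T r) (extendSeq T b) = 0 then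
            (Fintype.card A : ℝ)⁻¹
          else Fintype.card A * L.relabelMass Φ (t + 1) (extendSeq T y) p (extendSeq T r)
            (Function.update (extendSeq T b) t x) /
            L.relabelMass Φ t (extendSeq T y) p (extendSeq T r) (extendSeq T b) := by
        intro p
        unfold relabelAct
        split_ifs <;> rfl
      simp only [h2]
      refine Measurable.ite ?_ measurable_const ?_
      · exact L.measurable_relabelMass Φ t _ _ _ (measurableSet_singleton 0)
      · exact ((L.measurable_relabelMass Φ (t + 1) _ _ _).const_mul _).div
          (L.measurable_relabelMass Φ t _ _ _)
    exact h.comp (measurable_extendSeq T)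

theorem stepProb_relabel [Nonempty A] [Nonempty Y] (L : AgentAlg A Y T)
    (Φ : CausalRelabeling A Y T) (y : Fin T → Y) (p : Fin T → Policy) (r b : Fin T → A)
    (t : Fin T) : (L.relabel Φ).stepProb y p r b t = L.relabelAct Φ t y b r p (b t) := by
  unfold stepProb relabel
  change L.relabelAct Φ t _ _ _ _ (b t) = _
  rw [L.relabelAct_congr Φ (agreeBelow_extendSeq_take _ y) (agreeBelow_extendSeq_take _ b)
    (agreeBelow_extendSeq_take _ r) (agreeBelow_extendSeq_take _ p)]

/-- The quotients that define `relabelAct` telescope; the powers of `card A` account for the rounds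
that the masses leave free. -/
theorem prefixProb_relabel [Nonempty A] [Nonempty Y] (L : AgentAlg A Y T)
    (Φ : CausalRelabeling A Y T) (y : Fin T → Y) (p : Fin T → Policy) (r b : Fin T → A)
    (n : ℕ) (hn : n ≤ T) :
    (L.relabel Φ).prefixProb n y p r b * (Fintype.card A : ℝ) ^ T =
      (Fintype.card A : ℝ) ^ n * L.relabelMass Φ n y p r b := by
  induction n with
  | zero => simp [prefixProb, relabelMass, AgreeBelow]
  | succ n ih =>
    have ih := ih (by omega)
    have hs := (L.relabel Φ).prefixProb_succ ⟨n, hn⟩ y p r b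
    have hm := L.card_mul_sum_relabelMass_succ Φ ⟨n, hn⟩ y p r b
    simp only at hs hm
    rw [hs, mul_right_comm, ih, stepProb_relabel, relabelAct]
    split_ifs with h
    -- A history of mass zero: its successors have nonnegative masses with sum zero, so both sides
    -- vanish and the uniform default in `relabelAct` is harmless.
    · simp only at h
      rw [h] at hm
      have hc : (Fintype.card A : ℝ) ≠ 0 := by positivity
      have hz := (mul_eq_zero.1 hm).resolve_left hc
      have := (Finset.sum_eq_zero_iff_of_nonneg
        fun x _ => L.relabelMass_nonneg Φ (n + 1) y p r _).1 hz (b ⟨n, hn⟩) (Finset.mem_univ _)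
      rw [Function.update_eq_self] at this
      rw [h, this]; simp
    · simp only [Function.update_eq_self] at h ⊢
      field_simp
      ring

/-- The relabelled algorithm generates the relabelled actions. -/
theorem expect_relabel [Nonempty A] [Nonempty Y] (L : AgentAlg A Y T)
    (Φ : CausalRelabeling A Y T) (y : Fin T → Y) (p : Fin T → Policy) (r : Fin T → A)
    (f : (Fin T → A) → ℝ) :
    (L.relabel Φ).expect y p r f = L.expect y p r fun a => f (Φ.toFun y p r a) := by
  classical
  have h : ∀ b, (L.relabel Φ).prob y p r b = L.relabelMass Φ T y p r b := by
    intro b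
    have := L.prefixProb_relabel Φ y p r b T le_rfl
    rw [prefixProb_self, mul_comm] at this
    exact mul_left_cancel₀ (by positivity) this
  unfold expect
  simp only [h, relabelMass, prefixProb_self, Finset.sum_mul]
  rw [Finset.sum_comm]
  refine Finset.sum_congr rfl fun a _ => ?_
  have h2 : ∀ b, AgreeBelow T (Φ.toFun y p r a) b ↔ Φ.toFun y p r a = b := fun b =>
    ⟨fun h => funext fun s => h s s.isLt, fun h => h ▸ AgreeBelow.refl _ _⟩
  simp [h2]

/-! ### Unpredictability of uniformly random states -/

/-- An Agent does not predict uniformly random states: if the policies and recommendations are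
functions of the past states, and `X` is a function of the past states and of the actions up to
round `t`, then `X` is uncorrelated with the state of round `t`. -/
theorem sum_expect_mul_eq_zero {T : ℕ} [Nonempty A] (L : AgentAlg A (Fin 2) T)
    (p : (Fin T → Fin 2) → Fin T → Policy) (r : (Fin T → Fin 2) → Fin T → A) (t : Fin T)
    (hp : ∀ y y', AgreeBelow t y y' → AgreeBelow (t + 1) (p y) (p y'))
    (hr : ∀ y y', AgreeBelow t y y' → AgreeBelow (t + 1) (r y) (r y'))
    (X : (Fin T → Fin 2) → (Fin T → A) → ℝ)
    (hX : ∀ y y' a a', AgreeBelow t y y' → AgreeBelow (t + 1) a a' → X y a = X y' a')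
    (ξ : Fin 2 → ℝ) (hξ : ξ 0 + ξ 1 = 0) :
    ∑ y, L.expect y (p y) (r y) (fun a => X y a * ξ (y t)) = 0 := by
  have h1 : ∀ y, L.expect y (p y) (r y) (fun a => X y a * ξ (y t)) =
      ξ (y t) * L.expect y (p y) (r y) (X y) := by
    intro y
    rw [← L.expect_const_mul]
    congr 1
    funext a
    ring
  have h2 := card_mul_sum_eq_sum_update t fun y => L.expect y (p y) (r y)
    (fun a => X y a * ξ (y t))
  -- Redrawing the state of round `t` changes nothing that `X` depends on, so the two values of `ξ`
  -- meet the same expectation and cancel.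
  have h3 : ∀ y x, L.expect (Function.update y t x) (p (Function.update y t x))
      (r (Function.update y t x)) (X (Function.update y t x)) =
      L.expect y (p y) (r y) (X y) := fun y x =>
    L.expect_congr t (AgreeBelow.update y t x) (hp _ _ (AgreeBelow.update y t x))
      (hr _ _ (AgreeBelow.update y t x)) fun a a' ha => hX _ _ _ _ (AgreeBelow.update y t x) ha
  have h4 : ∀ z : ℝ, ξ 0 * z + ξ 1 * z = 0 := fun z => by rw [← add_mul, hξ, zero_mul]
  simp only [h1] at h2 ⊢
  simp only [h3, Function.update_self, Fin.sum_univ_two, h4, Finset.sum_const_zero] at h2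
  simpa using h2

end AgentAlg

end

noncomputable section

/-! ### The contract setting -/

/-- The higher one of two benchmark policies slightly above the cost of working. -/
def highPolicy : Policy := ⟨5 / 8, by norm_num, by norm_num⟩

/-- The lower one of two benchmark policies slightly above the cost of working. -/
def lowPolicy : Policy := ⟨9 / 16, by norm_num, by norm_num⟩

theorem coe_highPolicy : (highPolicy : ℝ) = 5 / 8 := rfl

theorem coe_lowPolicy : (lowPolicy : ℝ) = 9 / 16 := rfl

theorem highPolicy_ne_lowPolicy : highPolicy ≠ lowPolicy := fun h => by
  have := congrArg (Subtype.val) h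
  norm_num [highPolicy, lowPolicy] at this

/-- The linear contract setting in which the Agent works (action `1`, at cost `1/2`) or shirks
(action `0`, for free), and succeeds if it works in the good state `1`. -/
def workContract : LinearContract (Fin 2) (Fin 2) (Fin 2) where
  outcome a y := if a = 1 ∧ y = 1 then 1 else 0
  value o := if o = 1 then 1 else 0
  value_mem o := by split_ifs <;> simp
  cost a := if a = 1 then 1 / 2 else 0
  cost_mem a := by split_ifs <;> norm_num
  cost_injective := by
    intro a b
    fin_cases a <;> fin_cases b <;> simp
  benchmark := {highPolicy, lowPolicy}
  benchmark_nonempty := ⟨_, Finset.mem_insert_self _ _⟩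

/-- The Agent's gain from working. -/
def workGain (p : Policy) (y : Fin 2) : ℝ := (if y = 1 then (p : ℝ) else 0) - 1 / 2

theorem workContract_U (a : Fin 2) (p : Policy) (y : Fin 2) :
    workContract.U a p y = if a = 1 then workGain p y else 0 := by
  fin_cases a <;> fin_cases y <;> simp [LinearContract.U, workContract, workGain]

theorem workContract_V (a : Fin 2) (p : Policy) (y : Fin 2) :
    workContract.V a p y = if a = 1 then (if y = 1 then 1 - (p : ℝ) else 0) else 0 := by
  fin_cases a <;> fin_cases y <;> simp [LinearContract.V, workContract]

theorem abs_workGain_le (p : Policy) (y : Fin 2) : |workGain p y| ≤ 1 / 2 := by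
  have h0 := p.2.1
  have h1 := p.2.2
  unfold workGain
  rw [abs_le]
  split_ifs <;> constructor <;> linarith

theorem abs_workContract_U_le (a : Fin 2) (p : Policy) (y : Fin 2) :
    |workContract.U a p y| ≤ 1 / 2 := by
  rw [workContract_U]
  split_ifs
  · exact abs_workGain_le p y
  · norm_num

/-! ### Switching with a bounded ledger -/

section Ledger

variable {T : ℕ} (q : Policy) (z y : Fin T → Fin 2) (p : Fin T → Policy) (r a : Fin T → Fin 2)

/-- The condition, in terms of the ledger `l` of past gains, under which the Agent switches from
shirking to working in round `t`. The Agent believes that the state sequence is `z`. -/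
def SwitchCond (t : Fin T) (l : Fin 2 → ℝ) : Prop :=
  AgreeBelow t y z ∧ p t = q ∧ a t = 0 ∧ (z t = 1 ↔ l (r t) ≤ 0)

instance (t : Fin T) (l : Fin 2 → ℝ) : Decidable (SwitchCond q z y p r a t l) :=
  Classical.propDecidable _

/-- The total gain from the switches in the first `n` rounds, for each recommendation. -/
def ledger : ℕ → Fin 2 → ℝ
  | 0, _ => 0
  | n + 1, c => ledger n c + if h : n < T then
      (if r ⟨n, h⟩ = c ∧ SwitchCond q z y p r a ⟨n, h⟩ (ledger n) then
        workGain q (y ⟨n, h⟩) else 0) else 0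

/-- The Agent switches from shirking to working in round `t`. -/
def Switches (t : Fin T) : Prop := SwitchCond q z y p r a t (ledger q z y p r a t)

instance (t : Fin T) : Decidable (Switches q z y p r a t) :=
  Classical.propDecidable _

/-- The gain from a switch in round `t` under recommendation `c`. -/
def switchGain (t : Fin T) (c : Fin 2) : ℝ :=
  if r t = c ∧ Switches q z y p r a t then workGain q (y t) else 0

theorem ledger_succ (t : Fin T) (c : Fin 2) :
    ledger q z y p r a (t + 1) c = ledger q z y p r a t c + switchGain q z y p r a t c := by
  simp only [ledger, t.isLt, dite_true, switchGain]
  congr 1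

theorem sum_switchGain (c : Fin 2) :
    ∑ t, switchGain q z y p r a t c = ledger q z y p r a T c := by
  have h : ∀ t : Fin T, switchGain q z y p r a t c =
      ledger q z y p r a (t + 1) c - ledger q z y p r a t c := fun t => by
    rw [ledger_succ]; ring
  simp only [h]
  rw [Fin.sum_univ_eq_sum_range
    (fun n => ledger q z y p r a (n + 1) c - ledger q z y p r a n c),
    Finset.sum_range_sub (fun n => ledger q z y p r a n c)]
  simp [ledger]

/-- While the guess is right, a step up, of size at most 1/2, starts from a nonpositive balance and
a step down by 1/2 from a positive one. The first wrong guess can add another 1/2 in absolute value,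
after which switching stops for good. -/
theorem ledger_le {q : Policy} (hq : 1 / 2 ≤ (q : ℝ)) (n : ℕ) (hn : n ≤ T) (c : Fin 2) :
    (AgreeBelow n y z → |ledger q z y p r a n c| ≤ 1 / 2) ∧ |ledger q z y p r a n c| ≤ 1 := by
  induction n with
  | zero => simp [ledger]
  | succ n ih =>
    obtain ⟨ih1, ih2⟩ := ih (by omega)
    have hs := ledger_succ q z y p r a ⟨n, hn⟩ c
    simp only at hs
    rw [hs]
    unfold switchGain
    split_ifs with h
    · obtain ⟨hc, hy, -, -, hz⟩ := h
      simp only at hy hz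
      rw [hc] at hz
      have h1 := ih1 hy
      have hg := abs_workGain_le q (y ⟨n, hn⟩)
      refine ⟨fun hy' => ?_, (abs_add_le _ _).trans (by linarith)⟩
      have hyz : y ⟨n, hn⟩ = z ⟨n, hn⟩ := hy' _ (Nat.lt_succ_self n)
      rw [abs_le] at h1 hg ⊢
      rw [hyz] at hg ⊢
      by_cases h2 : z ⟨n, hn⟩ = 1
      · have h3 := hz.1 h2
        have h4 : 0 ≤ workGain q (z ⟨n, hn⟩) := by simp only [workGain, h2, if_true]; linarith
        constructor <;> linarith [hg.2]
      · have h3 := not_le.1 (fun h => h2 (hz.2 h))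
        have h4 : workGain q (z ⟨n, hn⟩) = -(1 / 2) := by simp [workGain, h2]
        rw [h4]
        constructor <;> linarith [h1.2]
    · rw [add_zero]
      exact ⟨fun hy => ih1 (hy.mono (Nat.le_succ n)), ih2⟩

end Ledger

/-! ### Causality of the switches -/

section Congr

variable {T : ℕ} {q : Policy} {z z' y y' : Fin T → Fin 2} {p p' : Fin T → Policy}
  {r r' a a' : Fin T → Fin 2}

theorem switchCond_congr {t : Fin T} (l : Fin 2 → ℝ) (hz : AgreeBelow (t + 1) z z')
    (hy : AgreeBelow t y y') (hp : AgreeBelow (t + 1) p p') (hr : AgreeBelow (t + 1) r r')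
    (ha : AgreeBelow (t + 1) a a') :
    SwitchCond q z y p r a t l ↔ SwitchCond q z' y' p' r' a' t l := by
  have ht := Nat.lt_succ_self (t : ℕ)
  simp only [SwitchCond, hz t ht, hp t ht, hr t ht, ha t ht]
  exact and_congr_left' (agreeBelow_congr hy (hz.mono ht.le))

/-- The guess is allowed to vary together with the states, because the averaging argument sets `z =
y`: the ledger before round `t` must then be independent of the state of round `t`. -/
theorem ledger_congr {n : ℕ} (hn : n ≤ T) (hz : AgreeBelow n z z')
    (hy : AgreeBelow n y y') (hp : AgreeBelow n p p') (hr : AgreeBelow n r r')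
    (ha : AgreeBelow n a a') : ledger q z y p r a n = ledger q z' y' p' r' a' n := by
  induction n with
  | zero => rfl
  | succ n ih =>
    have hl := Nat.le_succ n
    have ih := ih (by omega) (hz.mono hl) (hy.mono hl) (hp.mono hl) (hr.mono hl) (ha.mono hl)
    funext c
    have hs := switchCond_congr (q := q) (t := ⟨n, hn⟩) (ledger q z' y' p' r' a' n) hz
      (hy.mono hl) hp hr ha
    have ht : ((⟨n, hn⟩ : Fin T) : ℕ) < n + 1 := Nat.lt_succ_self n
    have e := ledger_succ q z y p r a ⟨n, hn⟩ c
    have e' := ledger_succ q z' y' p' r' a' ⟨n, hn⟩ c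
    simp only at e e'
    rw [e, e', ih, switchGain, switchGain, hy _ ht, hr _ ht]
    congr 1
    refine if_congr (and_congr_right' ?_) rfl rfl
    unfold Switches
    rw [ih]
    exact hs

theorem switches_congr {t : Fin T} (hz : AgreeBelow (t + 1) z z')
    (hy : AgreeBelow t y y') (hp : AgreeBelow (t + 1) p p') (hr : AgreeBelow (t + 1) r r')
    (ha : AgreeBelow (t + 1) a a') :
    Switches q z y p r a t ↔ Switches q z' y' p' r' a' t := by
  have hl := Nat.le_succ (t : ℕ)
  unfold Switches
  rw [ledger_congr t.isLt.le (hz.mono hl) hy (hp.mono hl) (hr.mono hl) (ha.mono hl)]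
  exact switchCond_congr _ hz hy hp hr ha

end Congr

/-! ### Measurability of the switches -/

section Measurability

variable {T : ℕ} (q : Policy) (z y : Fin T → Fin 2) (r a : Fin T → Fin 2)

/-- A property of policies that depends only on which of them equal `q` is measurable. -/
theorem measurableSet_of_eq_iff (P : (Fin T → Policy) → Prop)
    (hP : ∀ p p', (∀ t, p t = q ↔ p' t = q) → (P p ↔ P p')) : MeasurableSet {p | P p} := by
  classical
  let g : (Fin T → Policy) → Fin T → Bool := fun p t => decide (p t = q)
  have hg : Measurable g := measurable_pi_iff.2 fun t =>
    measurable_to_bool (by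
      have : (fun p : Fin T → Policy => g p t) ⁻¹' {true} = (fun p => p t) ⁻¹' {q} := by
        ext p; simp [g]
      rw [this]
      exact measurable_pi_apply t (measurableSet_singleton q))
  -- The set is saturated for `g`, whose codomain is finite.
  have : {p | P p} = g ⁻¹' (g '' {p | P p}) := by
    ext p
    constructor
    · exact fun h => ⟨p, h, rfl⟩
    · rintro ⟨p', h', he⟩
      refine (hP p' p fun t => ?_).1 h'
      have := congrFun he t
      simpa [g] using this
  rw [this]
  exact hg (Set.toFinite _).measurableSet

theorem switchCond_congr_policy {p p' : Fin T → Policy} (h : ∀ t, p t = q ↔ p' t = q) (t : Fin T)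
    (l : Fin 2 → ℝ) : SwitchCond q z y p r a t l ↔ SwitchCond q z y p' r a t l := by
  simp only [SwitchCond, h t]

theorem ledger_congr_policy {p p' : Fin T → Policy} (h : ∀ t, p t = q ↔ p' t = q) (n : ℕ) :
    ledger q z y p r a n = ledger q z y p' r a n := by
  induction n with
  | zero => rfl
  | succ n ih =>
    funext c
    simp only [ledger, ih]
    congr 1
    split_ifs with hn h1 h2 h2
    · rfl
    · exact absurd ⟨h1.1, (switchCond_congr_policy q z y r a h _ _).1 h1.2⟩ h2
    · exact absurd ⟨h2.1, (switchCond_congr_policy q z y r a h _ _).2 h2.2⟩ h1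
    · rfl
    · rfl

theorem switches_congr_policy {p p' : Fin T → Policy} (h : ∀ t, p t = q ↔ p' t = q) (t : Fin T) :
    Switches q z y p r a t ↔ Switches q z y p' r a t := by
  unfold Switches
  rw [ledger_congr_policy q z y r a h]
  exact switchCond_congr_policy q z y r a h t _

end Measurability

/-- The Agent switches from shirking to working in some rounds in which the policy is `q`. It
believes that the state sequence is `z`, and uses this knowledge to work in the good state, but
keeps its total gain from switching bounded by also working in the bad state. -/
def switchRelabeling {T : ℕ} (q : Policy) (z : Fin T → Fin 2) :
    CausalRelabeling (Fin 2) (Fin 2) T where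
  toFun y p r a t := if Switches q z y p r a t then 1 else a t
  causal t _ _ _ _ _ _ _ _ hy hp hr ha :=
    if_congr (switches_congr (AgreeBelow.refl _ z) hy hp hr ha) rfl (ha t (Nat.lt_succ_self _))
  measurableSet_eq y r a t b := by
    refine measurableSet_of_eq_iff q _ fun p p' h => ?_
    rw [if_congr (switches_congr_policy q z y r a h t) rfl rfl]

/-! ### Regrets of the switching Agent -/

section Regret

variable {T : ℕ} (q : Policy) (z y : Fin T → Fin 2) (p : Fin T → Policy) (r a : Fin T → Fin 2)

theorem Switches.policy_eq {t : Fin T} (h : Switches q z y p r a t) : p t = q := h.2.1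

theorem Switches.action_eq {t : Fin T} (h : Switches q z y p r a t) : a t = 0 := h.2.2.1

theorem sum_U_switchRelabeling :
    ∑ t, workContract.U ((switchRelabeling q z).toFun y p r a t) (p t) (y t) =
      ∑ t, workContract.U (a t) (p t) (y t) + ∑ c, ledger q z y p r a T c := by
  simp only [← sum_switchGain]
  rw [Finset.sum_comm, ← Finset.sum_add_distrib]
  refine Finset.sum_congr rfl fun t _ => ?_
  simp only [switchRelabeling, switchGain]
  by_cases h : Switches q z y p r a t
  · simp [h, h.policy_eq, h.action_eq, workContract_U]
  · simp [h]

/-- For a fixed `h`, a switch under recommendation `c` changes the summand by a multiple of the gain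
from work, and the multiplier depends only on `c`. The whole change is thus a combination of the two
ledger totals; this is why the ledger is kept per recommendation. -/
theorem sum_swap_switchRelabeling_le (hq : 1 / 2 ≤ (q : ℝ)) (h : Policy → Fin 2 → Fin 2 → Fin 2) :
    ∑ t, (workContract.U (h (p t) (r t) ((switchRelabeling q z).toFun y p r a t)) (p t) (y t) -
        workContract.U ((switchRelabeling q z).toFun y p r a t) (p t) (y t)) ≤
      ∑ t, (workContract.U (h (p t) (r t) (a t)) (p t) (y t) -
        workContract.U (a t) (p t) (y t)) + 4 := by
  -- After a switch `h` sees action 1 instead of 0, and the subtracted utility of the Agent rises by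
  -- the gain from work.
  let k : Fin 2 → ℝ := fun c =>
    (if h q c 1 = 1 then 1 else 0) - (if h q c 0 = 1 then 1 else 0) - 1
  have hk : ∀ c, |k c| ≤ 2 := fun c => by
    simp only [k]; rw [abs_le]; split_ifs <;> norm_num
  have e : ∑ t, (workContract.U (h (p t) (r t) ((switchRelabeling q z).toFun y p r a t))
        (p t) (y t) - workContract.U ((switchRelabeling q z).toFun y p r a t) (p t) (y t)) =
      ∑ t, (workContract.U (h (p t) (r t) (a t)) (p t) (y t) -
        workContract.U (a t) (p t) (y t)) + ∑ c, k c * ledger q z y p r a T c := by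
    simp only [← sum_switchGain, Finset.mul_sum]
    rw [Finset.sum_comm, ← Finset.sum_add_distrib]
    refine Finset.sum_congr rfl fun t _ => ?_
    simp only [switchRelabeling, switchGain]
    by_cases hs : Switches q z y p r a t
    · have hr : ∀ c : Fin 2, k c * (if r t = c ∧ Switches q z y p r a t then
          workGain q (y t) else 0) = if r t = c then k c * workGain q (y t) else 0 := by
        intro c; by_cases hc : r t = c <;> simp [hc, hs]
      simp only [hr, Finset.sum_ite_eq, Finset.mem_univ, if_true]
      simp only [hs, hs.policy_eq, hs.action_eq, workContract_U, if_true, k]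
      split_ifs <;> (simp_all; try ring)
    · simp [hs]
  rw [e]
  have hb : ∀ c, k c * ledger q z y p r a T c ≤ 2 := fun c => by
    have h1 := (ledger_le z y p r a hq T le_rfl c).2
    calc k c * ledger q z y p r a T c ≤ |k c| * |ledger q z y p r a T c| := by
          rw [← abs_mul]; exact le_abs_self _
      _ ≤ 2 * 1 := mul_le_mul (hk c) h1 (abs_nonneg _) (by norm_num)
      _ = 2 := by norm_num
  rw [Fin.sum_univ_two]
  linarith [hb 0, hb 1]

theorem abs_sum_ledger_le (hq : 1 / 2 ≤ (q : ℝ)) : |∑ c, ledger q z y p r a T c| ≤ 2 := by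
  have h0 := (ledger_le z y p r a hq T le_rfl 0).2
  have h1 := (ledger_le z y p r a hq T le_rfl 1).2
  rw [Fin.sum_univ_two]
  exact (abs_add_le _ _).trans (by linarith)

theorem bddAbove_swap :
    BddAbove (Set.range fun h : Policy → Fin 2 → Fin 2 → Fin 2 => (1 / (T : ℝ)) *
      ∑ t, (workContract.U (h (p t) (r t) (a t)) (p t) (y t) -
        workContract.U (a t) (p t) (y t))) := by
  refine ⟨(1 / (T : ℝ)) * ∑ _t : Fin T, 1, ?_⟩
  rintro _ ⟨h, rfl⟩
  refine mul_le_mul_of_nonneg_left (Finset.sum_le_sum fun t _ => ?_) (by positivity)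
  have h1 := abs_le.1 (abs_workContract_U_le (h (p t) (r t) (a t)) (p t) (y t))
  have h2 := abs_le.1 (abs_workContract_U_le (a t) (p t) (y t))
  linarith

theorem swapRegret_relabel_le (L : AgentAlg (Fin 2) (Fin 2) T) (hq : 1 / 2 ≤ (q : ℝ)) :
    workContract.swapRegret (L.relabel (switchRelabeling q z)) y p r ≤
      workContract.swapRegret L y p r + (1 / (T : ℝ)) * 4 := by
  unfold LinearContract.swapRegret
  rw [AgentAlg.expect_relabel, ← L.expect_const y p r ((1 / (T : ℝ)) * 4), ← L.expect_add]
  refine L.expect_mono fun a => ciSup_le fun h => ?_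
  refine le_trans ?_ (add_le_add_left (le_ciSup (bddAbove_swap y p r a) h) _)
  rw [← mul_add]
  exact mul_le_mul_of_nonneg_left (sum_swap_switchRelabeling_le q z y p r a hq h) (by positivity)

/-- The comparison maximum does not involve the actions, so only the Agent's own utility changes, by
the sum of the ledgers. -/
theorem negRegret_relabel_le (L : AgentAlg (Fin 2) (Fin 2) T) (hq : 1 / 2 ≤ (q : ℝ)) :
    workContract.negRegret (L.relabel (switchRelabeling q z)) y p r ≤
      workContract.negRegret L y p r + (1 / (T : ℝ)) * 4 := by
  unfold LinearContract.negRegret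
  rw [AgentAlg.expect_relabel, ← mul_add]
  refine mul_le_mul_of_nonneg_left ?_ (by positivity)
  rw [← L.expect_const y p r 4, ← L.expect_add]
  refine L.expect_mono fun a => ?_
  rw [sum_U_switchRelabeling]
  have := abs_le.1 (abs_sum_ledger_le q z y p r a hq)
  linarith [this.2]

end Regret

end

noncomputable section

/-! ### The Principal's utility averaged over the states -/

/-- The centred indicator of the good state. -/
def stateNoise (y : Fin 2) : ℝ := (if y = 1 then 1 else 0) - 1 / 2

theorem stateNoise_add : stateNoise 0 + stateNoise 1 = 0 := by norm_num [stateNoise]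

/-- A sequence, generated along a state sequence, whose entry in round `t` is a function of the
states before round `t`. -/
def Nonanticipating {α : Type} {T : ℕ} (p : (Fin T → Fin 2) → Fin T → α) : Prop :=
  ∀ (t : Fin T) (y y' : Fin T → Fin 2), AgreeBelow t y y' → p y t = p y' t

theorem Nonanticipating.agreeBelow {α : Type} {T : ℕ} {p : (Fin T → Fin 2) → Fin T → α}
    (h : Nonanticipating p) (t : Fin T) (y y' : Fin T → Fin 2) (hy : AgreeBelow t y y') :
    AgreeBelow (t + 1) (p y) (p y') :=
  fun s hs => h s y y' (hy.mono (Nat.lt_succ_iff.1 hs))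

section

variable {T : ℕ} (L : AgentAlg (Fin 2) (Fin 2) T)

theorem sum_expect_sum_noise (p : (Fin T → Fin 2) → Fin T → Policy)
    (r : (Fin T → Fin 2) → Fin T → Fin 2) (hp : Nonanticipating p) (hr : Nonanticipating r)
    (X : Fin T → (Fin T → Fin 2) → (Fin T → Fin 2) → ℝ)
    (hX : ∀ (t : Fin T) y y' a a', AgreeBelow t y y' → AgreeBelow (t + 1) a a' → X t y a = X t y' a') :
    ∑ y, L.expect y (p y) (r y) (fun a => ∑ t, X t y a * stateNoise (y t)) = 0 := by
  simp only [AgentAlg.expect_sum]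
  rw [Finset.sum_comm]
  exact Finset.sum_eq_zero fun t _ => L.sum_expect_mul_eq_zero p r t (hp.agreeBelow t)
    (hr.agreeBelow t) (X t) (hX t) stateNoise stateNoise_add

theorem neg_expect_U_le_swapRegret (y : Fin T → Fin 2) (p : Fin T → Policy)
    (r : Fin T → Fin 2) :
    (1 / (T : ℝ)) * L.expect y p r (fun a => -∑ t, workContract.U (a t) (p t) (y t)) ≤
      workContract.swapRegret L y p r := by
  unfold LinearContract.swapRegret
  rw [← L.expect_const_mul]
  refine L.expect_mono fun a => ?_
  -- The deviation to constant shirking has utility 0.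
  refine le_trans (le_of_eq ?_) (le_ciSup (bddAbove_swap y p r a) fun _ _ _ => 0)
  simp [workContract_U]

theorem principalValue_eq (y : Fin T → Fin 2) (p : Fin T → Policy) (r : Fin T → Fin 2) :
    workContract.principalValue L y p r =
      (1 / (T : ℝ)) * L.expect y p r fun a => ∑ t, workContract.V (a t) (p t) (y t) :=
  L.expect_const_mul y p r _ _

/-- The Principal's utility is welfare minus the Agent's utility, and the latter differs from that
of the simulated actions by at least -2. Work contributes welfare `ξ = stateNoise (y t)`, shirking
0. In a round with policy `q` the bound is max(0, ξ) = ξ/2 + 1/4, as ξ is 1/2 or -1/2; in other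
rounds the action is that of the uninformed algorithm. -/
theorem sum_V_switchRelabeling_le (q : Policy) (hq : 1 / 2 ≤ (q : ℝ)) (y : Fin T → Fin 2)
    (p : Fin T → Policy) (r a : Fin T → Fin 2) :
    ∑ t, workContract.V ((switchRelabeling q y).toFun y p r a t) (p t) (y t) ≤
      -∑ t, workContract.U (a t) (p t) (y t) +
      (∑ t, (if p t = q then 1 / 2 else if a t = 1 then 1 else 0) * stateNoise (y t) +
      (∑ t, (if p t = q then 1 / 4 else 0) + 2)) := by
  have h1 := sum_U_switchRelabeling q y y p r a
  have h2 := (abs_le.1 (abs_sum_ledger_le q y y p r a hq)).1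
  have h3 : ∑ t, workContract.V ((switchRelabeling q y).toFun y p r a t) (p t) (y t) +
      ∑ t, workContract.U ((switchRelabeling q y).toFun y p r a t) (p t) (y t) ≤
      ∑ t, (if p t = q then 1 / 2 else if a t = 1 then 1 else 0) * stateNoise (y t) +
      ∑ t, (if p t = q then 1 / 4 else 0) := by
    rw [← Finset.sum_add_distrib, ← Finset.sum_add_distrib]
    refine Finset.sum_le_sum fun t _ => ?_
    rw [workContract_U, workContract_V]
    by_cases hpq : p t = q
    · simp only [hpq, if_true, workGain, stateNoise]
      split_ifs <;> linarith
    · have hs : ¬ Switches q y y p r a t := fun h => hpq h.policy_eq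
      simp only [hpq, if_false, switchRelabeling, hs, workGain, stateNoise]
      split_ifs <;> linarith
  linarith

/-- On average over the states, the Principal's utility exceeds `0` only through the rounds with
policy `q`, on which the Agent is informed. -/
theorem sum_principalValue_le (q : Policy) (hq : 1 / 2 ≤ (q : ℝ))
    (p : (Fin T → Fin 2) → Fin T → Policy) (r : (Fin T → Fin 2) → Fin T → Fin 2)
    (hp : Nonanticipating p) (hr : Nonanticipating r) (ε : ℝ)
    (hL : ∀ y, workContract.swapRegret L y (p y) (r y) ≤ ε) :
    ∑ y, workContract.principalValue (L.relabel (switchRelabeling q y)) y (p y) (r y) ≤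
      ∑ y : Fin T → Fin 2, (ε + 1 / (T : ℝ) * (∑ t, (if p y t = q then 1 / 4 else 0) + 2)) := by
  have h0 : (0 : ℝ) ≤ 1 / T := by positivity
  let N : (Fin T → Fin 2) → (Fin T → Fin 2) → ℝ := fun y a =>
    ∑ t, (if p y t = q then 1 / 2 else if a t = 1 then 1 else 0) * stateNoise (y t)
  have hN : ∑ y, L.expect y (p y) (r y) (N y) = 0 := by
    refine sum_expect_sum_noise L p r hp hr
      (fun t y a => if p y t = q then 1 / 2 else if a t = 1 then 1 else 0) ?_
    intro t y y' a a' hy ha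
    simp only [hp t y y' hy, ha t (Nat.lt_succ_self _)]
  have h : ∀ y, workContract.principalValue (L.relabel (switchRelabeling q y)) y (p y) (r y) ≤
      (ε + 1 / (T : ℝ) * (∑ t, (if p y t = q then 1 / 4 else 0) + 2)) +
        1 / (T : ℝ) * L.expect y (p y) (r y) (N y) := by
    intro y
    rw [principalValue_eq, AgentAlg.expect_relabel]
    have h1 := L.expect_mono (y := y) (p := p y) (r := r y)
      (sum_V_switchRelabeling_le q hq y (p y) (r y))
    rw [L.expect_add, L.expect_add, L.expect_const] at h1
    have h2 := mul_le_mul_of_nonneg_left h1 h0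
    have h3 := (neg_expect_U_le_swapRegret L y (p y) (r y)).trans (hL y)
    simp only [mul_add] at h2 ⊢
    simp only [N]
    linarith
  refine (Finset.sum_le_sum fun y _ => h y).trans (le_of_eq ?_)
  rw [Finset.sum_add_distrib, ← Finset.mul_sum, hN, mul_zero, add_zero]

/-- The coefficient of the noise in the utility under the constant policy `q`. -/
def constNoiseCoeff (q : Policy) (r : (Fin T → Fin 2) → Fin T → Fin 2) (t : Fin T)
    (y a : Fin T → Fin 2) : ℝ :=
  if a t = 1 then 2 * q else
    if ledger q y y (fun _ => q) (r y) a t (r y t) ≤ 0 then 1 else -1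

/-- The coefficients make `key` an equality in every round in which the simulated action is
shirking. If it is work, the slack is nonnegative because `q` is at least 1/2. Summed up, the switch
gains are ledger totals, at least -2, which with the factor 2 accounts for the 4. -/
theorem le_sum_V_const (q : Policy) (hq : 1 / 2 ≤ (q : ℝ)) (r : (Fin T → Fin 2) → Fin T → Fin 2)
    (y a : Fin T → Fin 2) :
    (1 - (q : ℝ)) * (∑ t, constNoiseCoeff q r t y a * stateNoise (y t) + (T / 2 - 4)) ≤
      2 * q * ∑ t, workContract.V
        ((switchRelabeling q y).toFun y (fun _ => q) (r y) a t) q (y t) := by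
  have hq1 : 0 ≤ 1 - (q : ℝ) := sub_nonneg.2 q.2.2
  have h2 := (abs_le.1 (abs_sum_ledger_le q y y (fun _ => q) (r y) a hq)).1
  have key : ∀ t, (1 - (q : ℝ)) * (constNoiseCoeff q r t y a * stateNoise (y t) + 1 / 2 +
      2 * ∑ c, switchGain q y y (fun _ => q) (r y) a t c) ≤
      2 * q * workContract.V
        ((switchRelabeling q y).toFun y (fun _ => q) (r y) a t) q (y t) := by
    intro t
    have hg : ∑ c, switchGain q y y (fun _ => q) (r y) a t c =
        if Switches q y y (fun _ => q) (r y) a t then workGain q (y t) else 0 := by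
      by_cases hs : Switches q y y (fun _ => q) (r y) a t <;> simp [switchGain, hs]
    have hs : Switches q y y (fun _ => q) (r y) a t ↔ a t = 0 ∧
        (y t = 1 ↔ ledger q y y (fun _ => q) (r y) a t (r y t) ≤ 0) := by
      simp [Switches, SwitchCond, AgreeBelow.refl]
    rw [hg, workContract_V]
    simp only [switchRelabeling, hs, constNoiseCoeff, workGain, stateNoise]
    have ha : a t = 0 ∨ a t = 1 := by omega
    rcases ha with ha | ha <;> by_cases hy : y t = 1 <;>
      by_cases hl : ledger q y y (fun _ => q) (r y) a t (r y t) ≤ 0 <;>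
      simp only [ha, hy, hl] <;> norm_num <;> nlinarith
  calc (1 - (q : ℝ)) * (∑ t, constNoiseCoeff q r t y a * stateNoise (y t) + (T / 2 - 4))
      ≤ (1 - (q : ℝ)) * ∑ t, (constNoiseCoeff q r t y a * stateNoise (y t) + 1 / 2 +
          2 * ∑ c, switchGain q y y (fun _ => q) (r y) a t c) := by
        refine mul_le_mul_of_nonneg_left ?_ hq1
        rw [Finset.sum_add_distrib, Finset.sum_add_distrib, ← Finset.mul_sum, Finset.sum_comm]
        simp only [sum_switchGain, Finset.sum_const, Finset.card_univ, Fintype.card_fin,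
          nsmul_eq_mul]
        linarith
    _ ≤ _ := by
        rw [Finset.mul_sum, Finset.mul_sum]
        exact Finset.sum_le_sum fun t _ => key t

/-- Under the constant policy `q`, the informed Agent works in most good states. -/
theorem le_sum_principalValue_const (q : Policy) (hq : 1 / 2 ≤ (q : ℝ))
    (r : (Fin T → Fin 2) → Fin T → Fin 2) (hr : Nonanticipating r) :
    ∑ _y : Fin T → Fin 2, (1 / (T : ℝ)) * ((1 - (q : ℝ)) * (T / 2 - 4)) ≤
      2 * q * ∑ y, workContract.principalValue (L.relabel (switchRelabeling q y)) y
        (fun _ => q) (r y) := by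
  have h0 : (0 : ℝ) ≤ 1 / T := by positivity
  let N : (Fin T → Fin 2) → (Fin T → Fin 2) → ℝ := fun y a =>
    ∑ t, constNoiseCoeff q r t y a * stateNoise (y t)
  have hN : ∑ y, L.expect y (fun _ => q) (r y) (N y) = 0 := by
    refine sum_expect_sum_noise L (fun _ _ => q) r (fun _ _ _ _ => rfl) hr
      (constNoiseCoeff q r) ?_
    intro t y y' a a' hy ha
    have hl : ledger q y y (fun _ => q) (r y) a t = ledger q y' y' (fun _ => q) (r y') a' t :=
      ledger_congr t.isLt.le hy hy (AgreeBelow.refl _ _)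
        ((hr.agreeBelow t y y' hy).mono (Nat.le_succ _)) (ha.mono (Nat.le_succ _))
    simp only [constNoiseCoeff, ha t (Nat.lt_succ_self _), hl, hr t y y' hy]
  have h : ∀ y, (1 / (T : ℝ)) * ((1 - (q : ℝ)) * (T / 2 - 4)) +
      (1 / (T : ℝ)) * ((1 - (q : ℝ)) * L.expect y (fun _ => q) (r y) (N y)) ≤
      2 * q * workContract.principalValue (L.relabel (switchRelabeling q y)) y
        (fun _ => q) (r y) := by
    intro y
    rw [principalValue_eq, AgentAlg.expect_relabel]
    have h1 := L.expect_mono (y := y) (p := fun _ => q) (r := r y)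
      (le_sum_V_const q hq r y)
    rw [L.expect_const_mul, L.expect_const_mul, L.expect_add, L.expect_const] at h1
    have h2 := mul_le_mul_of_nonneg_left h1 h0
    simp only [mul_add] at h2
    simp only [N]
    linarith
  rw [Finset.mul_sum]
  refine le_trans (le_of_eq ?_) (Finset.sum_le_sum fun y _ => h y)
  have hz : ∑ y, (1 / (T : ℝ)) * ((1 - (q : ℝ)) * L.expect y (fun _ => q) (r y) (N y)) = 0 := by
    rw [← Finset.mul_sum, ← Finset.mul_sum, hN, mul_zero, mul_zero]
  rw [Finset.sum_add_distrib, hz, add_zero]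

end

end

noncomputable section

/-! ### Averaging over benchmarks and states -/

section

variable {T : ℕ}

/-- The played policies are the same for both `q`, so the upper bounds on the realized value compete
for the same rounds. -/
theorem sum_le_principalValue_sub (L : AgentAlg (Fin 2) (Fin 2) T) (hT : 0 < T)
    (p : (Fin T → Fin 2) → Fin T → Policy) (r : (Fin T → Fin 2) → Fin T → Fin 2)
    (rc : Policy → (Fin T → Fin 2) → Fin T → Fin 2) (hp : Nonanticipating p)
    (hr : Nonanticipating r) (hrc : ∀ q, Nonanticipating (rc q)) (ε : ℝ)
    (hL : ∀ y, workContract.swapRegret L y (p y) (r y) ≤ ε) :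
    ∑ _y : Fin T → Fin 2, 2 * (1 / 25 - ε - 4 / T) ≤
      ∑ q ∈ workContract.benchmark, ∑ y,
        (workContract.principalValue (L.relabel (switchRelabeling q y)) y (fun _ => q) (rc q y) -
          workContract.principalValue (L.relabel (switchRelabeling q y)) y (p y) (r y)) := by
  have hT' : (0 : ℝ) < T := by exact_mod_cast hT
  have hh : 1 / 2 ≤ (highPolicy : ℝ) := by rw [coe_highPolicy]; norm_num
  have hl : 1 / 2 ≤ (lowPolicy : ℝ) := by rw [coe_lowPolicy]; norm_num
  have a1 := le_sum_principalValue_const L highPolicy hh (rc highPolicy) (hrc _)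
  have a2 := le_sum_principalValue_const L lowPolicy hl (rc lowPolicy) (hrc _)
  have b1 := sum_principalValue_le L highPolicy hh p r hp hr ε hL
  have b2 := sum_principalValue_le L lowPolicy hl p r hp hr ε hL
  rw [coe_highPolicy] at a1
  rw [coe_lowPolicy] at a2
  have hb : workContract.benchmark = {highPolicy, lowPolicy} := rfl
  rw [hb, Finset.sum_pair highPolicy_ne_lowPolicy, Finset.sum_sub_distrib,
    Finset.sum_sub_distrib]
  have c : ∑ y : Fin T → Fin 2,
      (ε + 1 / (T : ℝ) * (∑ t, (if p y t = highPolicy then 1 / 4 else 0) + 2)) +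
      ∑ y : Fin T → Fin 2,
      (ε + 1 / (T : ℝ) * (∑ t, (if p y t = lowPolicy then 1 / 4 else 0) + 2)) ≤
      ∑ _y : Fin T → Fin 2, (2 * ε + 1 / 4 + 4 / T) := by
    rw [← Finset.sum_add_distrib]
    refine Finset.sum_le_sum fun y _ => ?_
    -- A policy equals at most one of the two benchmarks.
    have h : ∑ t, (if p y t = highPolicy then (1 / 4 : ℝ) else 0) +
        ∑ t, (if p y t = lowPolicy then (1 / 4 : ℝ) else 0) ≤ T * (1 / 4) := by
      rw [← Finset.sum_add_distrib]
      refine (Finset.sum_le_sum (g := fun _ => (1 / 4 : ℝ)) fun t _ => ?_).trans (by simp)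
      by_cases h1 : p y t = highPolicy
      · simp [h1, highPolicy_ne_lowPolicy]
      · simp only [h1, if_false]
        split_ifs <;> norm_num
    have h2 := mul_le_mul_of_nonneg_left h (by positivity : (0 : ℝ) ≤ 1 / T)
    have h3 : 1 / (T : ℝ) * (T * (1 / 4)) = 1 / 4 := by field_simp
    have h4 : (4 : ℝ) / T = 4 * (1 / T) := by ring
    rw [h3] at h2
    rw [h4]
    linarith
  have e1 : ∀ k : ℝ, 1 / (T : ℝ) * (k * (T / 2 - 4)) = k * (1 / 2 - 4 / T) := fun k => by
    field_simp
  simp only [e1, Finset.sum_const, nsmul_eq_mul] at a1 a2 c ⊢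
  have hn : (0 : ℝ) ≤ (Finset.univ : Finset (Fin T → Fin 2)).card := by positivity
  have hi : (0 : ℝ) ≤ 4 / T := by positivity
  have := mul_nonneg hn hi
  -- Dividing by 2q turns the factors 1 - q into 3/10 and 7/18, and (3/10 + 7/18)/2 - 1/4 = 17/180
  -- exceeds 2/25. The terms in 1/T amount to less than 8/T.
  nlinarith

/-! ### Measurability and integrability of the Principal's regret -/

theorem measurable_workContract_V (a y : Fin 2) : Measurable fun q => workContract.V a q y := by
  simp only [workContract_V]
  split_ifs
  · exact measurable_const.sub measurable_subtype_coe
  · exact measurable_const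
  · exact measurable_const

theorem measurable_principalValue_policy (L : AgentAlg (Fin 2) (Fin 2) T) (y r : Fin T → Fin 2) :
    Measurable fun p => workContract.principalValue L y p r := by
  simp only [principalValue_eq, AgentAlg.expect]
  refine Measurable.const_mul (Finset.measurable_fun_sum _ fun a _ => Measurable.mul ?_ ?_) _
  · simpa only [AgentAlg.prefixProb_self] using L.measurable_prefixProb T y r a
  · exact Finset.measurable_fun_sum _ fun t _ =>
      (measurable_workContract_V (a t) (y t)).comp (measurable_pi_apply t)

/-- An Agent algorithm is measurable in the policies for fixed recommendations; joint measurability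
follows because recommendation sequences form a finite set. -/
theorem measurable_of_countable_left {Ω α β γ : Type} [MeasurableSpace Ω] [MeasurableSpace α]
    [MeasurableSpace β] [MeasurableSpace γ] [Countable α] [MeasurableSingletonClass α]
    {F : α → β → γ} (hF : ∀ a, Measurable (F a)) {f : Ω → α} {g : Ω → β} (hf : Measurable f)
    (hg : Measurable g) : Measurable fun ω => F (f ω) (g ω) := by
  have h : Measurable fun x : α × β => F x.1 x.2 := measurable_from_prod_countable_right hF
  exact h.comp (hf.prodMk hg)

theorem measurable_principalValue {Ω : Type} [MeasurableSpace Ω]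
    (L : AgentAlg (Fin 2) (Fin 2) T) (y : Fin T → Fin 2) {p : Ω → Fin T → Policy}
    {r : Ω → Fin T → Fin 2} (hp : Measurable p) (hr : Measurable r) :
    Measurable fun ω => workContract.principalValue L y (p ω) (r ω) :=
  measurable_of_countable_left (F := fun r p => workContract.principalValue L y p r)
    (measurable_principalValue_policy L y) hr hp

theorem principalValue_mem (L : AgentAlg (Fin 2) (Fin 2) T) (y : Fin T → Fin 2)
    (p : Fin T → Policy) (r : Fin T → Fin 2) :
    workContract.principalValue L y p r ∈ Set.Icc (0 : ℝ) 1 := by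
  have hV : ∀ a q x, workContract.V a q x ∈ Set.Icc (0 : ℝ) 1 := fun a q x => by
    have h0 := q.2.1
    have h1 := q.2.2
    rw [workContract_V]
    split_ifs <;> constructor <;> linarith
  unfold LinearContract.principalValue
  constructor
  · rw [← L.expect_const y p r 0]
    exact L.expect_mono fun a => mul_nonneg (by positivity)
      (Finset.sum_nonneg fun t _ => (hV _ _ _).1)
  · refine le_trans (L.expect_mono fun a => ?_) (L.expect_const y p r 1).le
    have h := Finset.sum_le_sum (s := Finset.univ) (g := fun _ : Fin T => (1 : ℝ))
      fun t _ => (hV (a t) (p t) (y t)).2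
    simp only [Finset.sum_const, Finset.card_univ, Fintype.card_fin, nsmul_eq_mul,
      mul_one] at h
    rw [one_div_mul_eq_div]
    exact div_le_one_of_le₀ h (by positivity)

variable (astar : workContract.OptimisticResponse) (σ : Mechanism (Fin 2) (Fin 2) T)

theorem measurable_policies (y : Fin T → Fin 2) : Measurable (σ.policies y) :=
  measurable_pi_iff.2 fun t => σ.measurable_policy t _

theorem measurable_recommendations (y : Fin T → Fin 2) : Measurable (σ.recommendations y) :=
  measurable_pi_iff.2 fun t => measurable_to_countable' fun a =>
    σ.measurableSet_recommend t _ a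

theorem measurable_constRecommendations (q : Policy) (y : Fin T → Fin 2) :
    Measurable (LinearContract.constRecommendations astar σ q y) :=
  measurable_pi_iff.2 fun t => measurable_to_countable' fun a =>
    σ.measurable_forecast t _ (astar.measurableSet_eq q a)

/-- The Principal's regret to the benchmark policy `q` in the realization `ω`. -/
def benchmarkRegret (L : AgentAlg (Fin 2) (Fin 2) T) (q : Policy) (y : Fin T → Fin 2)
    (ω : σ.Ω) : ℝ :=
  workContract.principalValue L y (fun _ => q)
    (LinearContract.constRecommendations astar σ q y ω) -
  workContract.principalValue L y (σ.policies y ω) (σ.recommendations y ω)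

theorem measurable_benchmarkRegret (L : AgentAlg (Fin 2) (Fin 2) T) (q : Policy)
    (y : Fin T → Fin 2) : Measurable (benchmarkRegret astar σ L q y) :=
  (measurable_principalValue L y measurable_const
    (measurable_constRecommendations astar σ q y)).sub
  (measurable_principalValue L y (measurable_policies σ y) (measurable_recommendations σ y))

theorem abs_benchmarkRegret_le (L : AgentAlg (Fin 2) (Fin 2) T) (q : Policy)
    (y : Fin T → Fin 2) (ω : σ.Ω) : |benchmarkRegret astar σ L q y ω| ≤ 1 := by
  have h1 := principalValue_mem L y (fun _ => q)
    (LinearContract.constRecommendations astar σ q y ω)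
  have h2 := principalValue_mem L y (σ.policies y ω) (σ.recommendations y ω)
  unfold benchmarkRegret
  rw [abs_le]
  constructor <;> linarith [h1.1, h1.2, h2.1, h2.2]

theorem integrable_benchmarkRegret (L : AgentAlg (Fin 2) (Fin 2) T) (q : Policy)
    (y : Fin T → Fin 2) : Integrable (benchmarkRegret astar σ L q y) σ.law :=
  Integrable.of_bound (measurable_benchmarkRegret astar σ L q y).aestronglyMeasurable 1
    (ae_of_all _ fun ω => abs_benchmarkRegret_le astar σ L q y ω)

theorem integral_benchmarkRegret_le (L : AgentAlg (Fin 2) (Fin 2) T) {q : Policy}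
    (hq : q ∈ workContract.benchmark) (y : Fin T → Fin 2) :
    ∫ ω, benchmarkRegret astar σ L q y ω ∂σ.law ≤ workContract.policyRegret astar σ L y := by
  have hm : Measurable fun ω => workContract.benchmark.sup' workContract.benchmark_nonempty
      fun p₀ => benchmarkRegret astar σ L p₀ y ω := by
    have := Finset.measurable_sup' workContract.benchmark_nonempty
      (f := fun p₀ => benchmarkRegret astar σ L p₀ y)
      fun p₀ _ => measurable_benchmarkRegret astar σ L p₀ y
    convert this using 1
    funext ω
    rw [Finset.sup'_apply]
  have hle : ∀ ω, benchmarkRegret astar σ L q y ω ≤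
      workContract.benchmark.sup' workContract.benchmark_nonempty
        fun p₀ => benchmarkRegret astar σ L p₀ y ω := fun ω =>
    Finset.le_sup' (fun p₀ => benchmarkRegret astar σ L p₀ y ω) hq
  refine integral_mono (integrable_benchmarkRegret astar σ L q y) ?_ hle
  refine Integrable.of_bound hm.aestronglyMeasurable 1 (ae_of_all _ fun ω => ?_)
  rw [Real.norm_eq_abs, abs_le]
  exact ⟨(abs_le.1 (abs_benchmarkRegret_le astar σ L q y ω)).1.trans (hle ω),
    Finset.sup'_le _ _ fun p₀ _ => (abs_le.1 (abs_benchmarkRegret_le astar σ L p₀ y ω)).2⟩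

/-- Some benchmark policy and state sequence make the Principal regret facing the Agent that is
informed about that sequence in the rounds with that policy. -/
theorem exists_le_policyRegret (L : AgentAlg (Fin 2) (Fin 2) T) (hT : 0 < T) (ε : ℝ)
    (hL : ∀ y, workContract.NoContextualSwapRegret astar σ L y ε) :
    ∃ q ∈ workContract.benchmark, ∃ y, 1 / 25 - ε - 4 / T ≤
      workContract.policyRegret astar σ (L.relabel (switchRelabeling q y)) y := by
  by_contra! hcon
  let D : Policy → (Fin T → Fin 2) → σ.Ω → ℝ := fun q y =>
    benchmarkRegret astar σ (L.relabel (switchRelabeling q y)) q y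
  have hD : ∀ q y, Integrable (D q y) σ.law := fun q y => integrable_benchmarkRegret _ _ _ _ _
  have h1 : ∀ᵐ ω ∂σ.law, ∑ _y : Fin T → Fin 2, 2 * (1 / 25 - ε - 4 / T) ≤
      ∑ q ∈ workContract.benchmark, ∑ y, D q y ω := by
    -- There are finitely many state sequences, so a single null set serves them all. For fixed `ω`
    -- the mechanism is deterministic and nonanticipating.
    filter_upwards [ae_all_iff.2 hL] with ω hω
    refine sum_le_principalValue_sub L hT (fun y => σ.policies y ω)
      (fun y => σ.recommendations y ω)
      (fun q y => LinearContract.constRecommendations astar σ q y ω) ?_ ?_ ?_ ε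
      fun y => (hω y).1
    · intro t y y' h
      simp only [Mechanism.policies, h.take]
    · intro t y y' h
      simp only [Mechanism.recommendations, h.take]
    · intro q t y y' h
      simp only [LinearContract.constRecommendations, Mechanism.forecasts, h.take]
  have h2 := integral_mono_ae (integrable_const _)
    (integrable_finsetSum _ fun q _ => integrable_finsetSum _ fun y _ => hD q y) h1
  rw [integral_const, integral_finsetSum _
    fun q _ => integrable_finsetSum _ fun y _ => hD q y] at h2
  simp only [integral_finsetSum _ fun y _ => hD _ y, probReal_univ, one_smul] at h2
  have h3 : ∑ q ∈ workContract.benchmark, ∑ y, ∫ ω, D q y ω ∂σ.law <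
      ∑ q ∈ workContract.benchmark, ∑ _y : Fin T → Fin 2, (1 / 25 - ε - 4 / (T : ℝ)) :=
    Finset.sum_lt_sum_of_nonempty workContract.benchmark_nonempty fun q hq =>
      Finset.sum_lt_sum_of_nonempty Finset.univ_nonempty fun y _ =>
        (integral_benchmarkRegret_le astar σ _ hq y).trans_lt (hcon q hq y)
  have hc : workContract.benchmark.card = 2 := Finset.card_pair highPolicy_ne_lowPolicy
  simp only [Finset.sum_const, hc, nsmul_eq_mul] at h2 h3
  push_cast at h2 h3
  linarith

theorem half_le_of_mem_benchmark {q : Policy} (hq : q ∈ workContract.benchmark) :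
    1 / 2 ≤ (q : ℝ) := by
  have hb : q ∈ ({highPolicy, lowPolicy} : Finset Policy) := hq
  rcases Finset.mem_insert.1 hb with rfl | h
  · rw [coe_highPolicy]; norm_num
  · rw [Finset.mem_singleton.1 h, coe_lowPolicy]; norm_num

end

/-! ### Conclusion -/

/-- The extra regret 4/T depends on neither the benchmark nor the guess, so both may be chosen
afresh for each horizon. -/
theorem vanishingRegrets_relabel (astar : workContract.OptimisticResponse)
    (σ : ∀ T : ℕ, Mechanism (Fin 2) (Fin 2) T) (L : ∀ T : ℕ, AgentAlg (Fin 2) (Fin 2) T)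
    (hL : workContract.VanishingRegrets astar σ L) (q : ℕ → Policy)
    (hq : ∀ T, 1 / 2 ≤ (q T : ℝ)) (z : ∀ T : ℕ, Fin T → Fin 2) :
    workContract.VanishingRegrets astar σ
      fun T => (L T).relabel (switchRelabeling (q T) (z T)) := by
  obtain ⟨ε₁, ε₂, h₁, h₂, h⟩ := hL
  have h0 : Tendsto (fun T : ℕ => (1 / (T : ℝ)) * 4) atTop (𝓝 0) := by
    simpa using tendsto_one_div_atTop_nhds_zero_nat.mul_const (4 : ℝ)
  refine ⟨fun T => ε₁ T + 1 / (T : ℝ) * 4, fun T => ε₂ T + 1 / (T : ℝ) * 4,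
    by simpa using h₁.add h0, by simpa using h₂.add h0, fun T y => ⟨?_, ?_⟩⟩
  · filter_upwards [(h T y).1] with ω hω
    exact ⟨(swapRegret_relabel_le _ _ _ _ _ _ (hq T)).trans (add_le_add_left hω.1 _),
      fun p₀ hp₀ => (swapRegret_relabel_le _ _ _ _ _ _ (hq T)).trans
        (add_le_add_left (hω.2 p₀ hp₀) _)⟩
  · filter_upwards [(h T y).2] with ω hω
    exact ⟨(negRegret_relabel_le _ _ _ _ _ _ (hq T)).trans (add_le_add_left hω.1 _),
      fun p₀ hp₀ => (negRegret_relabel_le _ _ _ _ _ _ (hq T)).trans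
        (add_le_add_left (hω.2 p₀ hp₀) _)⟩

end

theorem proposition3 :
    ∃ (S : LinearContract (Fin 2) (Fin 2) (Fin 2)) (c : ℝ), 0 < c ∧
      ∀ (astar : S.OptimisticResponse) (σ : ∀ T : ℕ, Mechanism (Fin 2) (Fin 2) T),
        (¬ ∃ L : ∀ T : ℕ, AgentAlg (Fin 2) (Fin 2) T, S.VanishingRegrets astar σ L) ∨
        (∃ L : ∀ T : ℕ, AgentAlg (Fin 2) (Fin 2) T, S.VanishingRegrets astar σ L ∧
          ∀ᶠ T : ℕ in atTop, ∃ y : Fin T → Fin 2, c ≤ S.policyRegret astar (σ T) (L T) y) := by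
  -- Half of the limiting bound 1/25; the other half absorbs the swap regret and 4/T for large
  -- horizons.
  refine ⟨workContract, 1 / 50, by norm_num, fun astar σ => ?_⟩
  refine or_iff_not_imp_left.2 fun hex => ?_
  obtain ⟨L, hL⟩ := not_not.1 hex
  obtain ⟨ε₁, ε₂, h₁, -, h⟩ := id hL
  have key : ∀ T : ℕ, ∃ q ∈ workContract.benchmark, ∃ y, 0 < T → 1 / 25 - ε₁ T - 4 / T ≤
      workContract.policyRegret astar (σ T) ((L T).relabel (switchRelabeling q y)) y := by
    intro T
    rcases Nat.eq_zero_or_pos T with hT | hT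
    -- Horizon 0 only needs some benchmark, so that the choice is defined for every `T`.
    · obtain ⟨q, hq⟩ := workContract.benchmark_nonempty
      exact ⟨q, hq, fun _ => 0, fun h => absurd hT h.ne'⟩
    · obtain ⟨q, hq, y, hy⟩ := exists_le_policyRegret astar (σ T) (L T) hT (ε₁ T)
        fun y => (h T y).1
      exact ⟨q, hq, y, fun _ => hy⟩
  choose q hq z hz using key
  refine ⟨_, vanishingRegrets_relabel astar σ L hL q
    (fun T => half_le_of_mem_benchmark (hq T)) z, ?_⟩
  have h0 : Tendsto (fun T : ℕ => ε₁ T + 4 / (T : ℝ)) atTop (𝓝 0) := by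
    simpa using h₁.add (tendsto_const_div_atTop_nhds_zero_nat 4)
  filter_upwards [h0.eventually_lt_const (by norm_num : (0 : ℝ) < 1 / 50),
    eventually_gt_atTop 0] with T hT hT0
  exact ⟨z T, le_trans (by linarith) (hz T hT0)⟩
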